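/- Let $\mathcal X$ be a measurable input space and let data points $(X,A,Y)$ take values in $\mathcal X\times\{0,1\}\times\{0,1\}$. For a distribution $\mathbb P$ of $(X,A,Y)$ and a classifier $h:\mathcal X\to\{0,1\}$ put $\mathcal R(h)=\mathbb P(h(X)\ne Y)$, $\mathcal D(h)=|\mathbb P(h(X)=1\mid A=0)-\mathbb P(h(X)=1\mid A=1)|$ and, for $\lambda\ge 0$, $L_\lambda(h)=\mathcal R(h)+\lambda\mathcal D(h)$. For a dataset $S=((x_i,a_i,y_i))_{i=1}^n$ put $$\widehat{\mathcal R}_S(h)=\frac1n\sum_{i=1}^n\mathbf 1\{h(x_i)\ne y_i\},\qquad \widehat{\mathcal D}_S(h)=\left|\frac{\sum_i\mathbf 1\{h(x_i)=1,a_i=0\}}{\sum_i\mathbf 1\{a_i=0\}}-\frac{\sum_i\mathbf 1\{h(x_i)=1,a_i=1\}}{\sum_i\mathbf 1\{a_i=1\}}\right|,$$ with $0/0=0$. There are universal constants $C,K>0$ such that the following holds. Let $\mathcal H$ be a set of classifiers $\mathcal X\to\{0,1\}$ with VC dimension $d<\infty$, let $\lambda\ge0$, and let $\mathcal L$ be any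 learner that maps every dataset $S$ of size $n\ge1$ to a minimizer of $\widehat{\mathcal R}_S(h)+\lambda\widehat{\mathcal D}_S(h)$ over $h\in\mathcal H$. Let $\mathbb P$ be a distribution of $(X,A,Y)$ with $0<P_0:=\mathbb P(A=0)\le\frac12$, and let $0\le\alpha<\frac12$. Assume that $\mathcal H$ satisfies the usual measurability conditions: every $h\in\mathcal H$ is measurable and, for all $m$ and $b\in\{0,1\}^m$, the set of $(x_1,\dots,x_m)\in\mathcal X^m$ for which some $h\in\mathcal H$ has $h(x_i)=b_i$ for all $i$ is measurable up to a null set of the $m$-fold product of the law of $X$. Set $$\Delta^{par}=\frac{2\alpha}{P_0/3+\alpha}.$$ Then $\Delta^{par}\le K\alpha/P_0$. Moreover let $\delta\in(0,1)$ and $$n\ge\max\left\{\frac{8\log(16/\delta)}{(1-\alpha)P_0},\ \frac{12\log(12/\delta)}{\alpha},\ \frac d2\right\}$$ (for $\alpha=0$ the second term is omitted). Let a clean dataset $S^c$ of $n$ points be drawn i.i.d. from $\mathbb P$, let every index in $\{1,\dots,n\}$ be marked independently with probability $\alpha$, independently of $S^c$, and let $S^p$ be any random dataset of size $n$ (chosen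 by a malicious, possibly randomized adversary of power $\alpha$, who may use full knowledge of $S^c$, the marks, $\mathbb P$ and $\mathcal L$) that coincides with $S^c$ at all unmarked indices. Then, with probability greater than $1-\delta$ over the clean data, the marks and the adversary, $$L_\lambda(\mathcal L(S^p))\le\inf_{h\in\mathcal H}L_\lambda(h)+3\alpha+2\lambda\Delta^{par}+C\sqrt{\log(2n/\delta)}\left(\sqrt{\frac dn}+\lambda\sqrt{\frac d{P_0n}}\right).$$ -/

import Mathlib

open MeasureTheory ProbabilityTheory

namespace FairLearning

noncomputable section

/-- A data point `(x, a, y)`: input, binary protected attribute, binary label. -/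
abbrev DataPoint (X : Type*) := X × Fin 2 × Fin 2

/-- A dataset of size `n`. -/
abbrev Dataset (X : Type*) (n : ℕ) := Fin n → DataPoint X

/-- `H` shatters the finite set `s` if every subset of `s` is cut out on `s` by some `h ∈ H`. -/
def Shatters {X : Type*} (H : Set (X → Fin 2)) (s : Finset X) : Prop :=
  ∀ t ⊆ s, ∃ h ∈ H, ∀ x ∈ s, (h x = 1 ↔ x ∈ t)

/-- The VC dimension: the supremum of the sizes of the finite shattered sets. -/
def vcDim {X : Type*} (H : Set (X → Fin 2)) : ℕ∞ :=
  ⨆ (s : Finset X) (_ : Shatters H s), (s.card : ℕ∞)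

/-- The usual measurability requirement on a hypothesis space, relative to the law `ν` of the
inputs: every hypothesis is measurable, and for every pattern `b` of labels the set of `m`-tuples
of inputs on which some hypothesis realises `b` is measurable up to a null set. (It holds for
countable classes, for pointwise limits of a countable subclass, for Suslin classes.) -/
structure MeasurableClass {X : Type*} [MeasurableSpace X] (H : Set (X → Fin 2))
    (ν : Measure X) : Prop where
  measurable : ∀ h ∈ H, Measurable h
  pattern : ∀ (m : ℕ) (b : Fin m → Fin 2),
    NullMeasurableSet {x : Fin m → X | ∃ h ∈ H, ∀ i, h (x i) = b i} (Measure.pi fun _ => ν)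

section Population

variable {X : Type*} [MeasurableSpace X]

/-- `P (A = a)`. -/
def groupProb (P : Measure (DataPoint X)) (a : Fin 2) : ℝ :=
  P.real {z | z.2.1 = a}

/-- The risk `P (h(X) ≠ Y)`. -/
def risk (P : Measure (DataPoint X)) (h : X → Fin 2) : ℝ :=
  P.real {z | h z.1 ≠ z.2.2}

/-- The conditional probability `P (h(X) = 1 | A = a)`. -/
def positiveRate (P : Measure (DataPoint X)) (h : X → Fin 2) (a : Fin 2) : ℝ :=
  (P[|{z | z.2.1 = a}]).real {z | h z.1 = 1}

/-- The mean difference score for demographic parity. -/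
def parityDeviation (P : Measure (DataPoint X)) (h : X → Fin 2) : ℝ :=
  |positiveRate P h 0 - positiveRate P h 1|

/-- The weighted objective `L_lam = risk + lam * deviation`. -/
def weightedObjective (P : Measure (DataPoint X)) (lam : ℝ) (h : X → Fin 2) : ℝ :=
  risk P h + lam * parityDeviation P h

end Population

section Empirical

variable {X : Type*} {n : ℕ}

/-- The empirical risk. -/
def empRisk (S : Dataset X n) (h : X → Fin 2) : ℝ :=
  ((Finset.univ.filter fun i => h (S i).1 ≠ (S i).2.2).card : ℝ) / n

/-- The fraction of positive predictions in group `a` of the dataset, with `0 / 0 = 0`. -/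
def empPositiveRate (S : Dataset X n) (h : X → Fin 2) (a : Fin 2) : ℝ :=
  ((Finset.univ.filter fun i => h (S i).1 = 1 ∧ (S i).2.1 = a).card : ℝ) /
    ((Finset.univ.filter fun i => (S i).2.1 = a).card : ℝ)

/-- The empirical estimate of the demographic parity deviation. -/
def empParityDeviation (S : Dataset X n) (h : X → Fin 2) : ℝ :=
  |empPositiveRate S h 0 - empPositiveRate S h 1|

/-- The empirical weighted objective. -/
def empObjective (S : Dataset X n) (lam : ℝ) (h : X → Fin 2) : ℝ :=
  empRisk S h + lam * empParityDeviation S h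

end Empirical

/-- The learner maps every nonempty dataset to a minimiser over `H` of the empirical weighted
objective. -/
def MinimizesEmpObjective {X : Type*} (H : Set (X → Fin 2)) (lam : ℝ)
    (learner : (n : ℕ) → Dataset X n → (X → Fin 2)) : Prop :=
  ∀ n : ℕ, 1 ≤ n → ∀ S : Dataset X n,
    learner n S ∈ H ∧ ∀ h ∈ H, empObjective S lam (learner n S) ≤ empObjective S lam h

/-- The data generation against a malicious adversary of power `α`, on a probability space that
carries the clean data, the marks and the randomness of the adversary: the clean points are i.i.d.
from `P`, every index is marked independently with probability `α`, the marks are independent of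
the clean data, and the corrupted dataset agrees with the clean one at the unmarked indices.
Nothing else is required of the corrupted dataset. -/
structure MaliciousSampling {X Ω : Type*} [MeasurableSpace X] [MeasurableSpace Ω] {n : ℕ}
    (P : Measure (DataPoint X)) (α : ℝ) (μ : Measure Ω)
    (clean : Ω → Dataset X n) (marked : Ω → Fin n → Bool) (corrupted : Ω → Dataset X n) :
    Prop where
  measurable_clean : Measurable clean
  clean_law : ∀ i, μ.map (fun ω => clean ω i) = P
  clean_indep : iIndepFun (fun (i : Fin n) (ω : Ω) => clean ω i) μ
  measurable_marked : Measurable marked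
  marked_prob : ∀ i, μ.real {ω | marked ω i = true} = α
  marked_indep : iIndepFun (fun (i : Fin n) (ω : Ω) => marked ω i) μ
  clean_marked_indep : IndepFun clean marked μ
  unmarked_eq : ∀ᵐ ω ∂μ, ∀ i, marked ω i = false → corrupted ω i = clean ω i

/-- The irreducible fairness term `2α / (P₀/3 + α)`. -/
def deltaPar (α P₀ : ℝ) : ℝ := 2 * α / (P₀ / 3 + α)

end

end FairLearning

/-!
The empirical objective sees the data only through counts: of marked indices, of errors, and, in
each group, of unmarked points and of unmarked points with a positive prediction. One deviation
theorem controls all of them uniformly over the class. Symmetrization with a ghost sample, followed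
by a union bound over the polynomially many patterns that a class of VC dimension `d` realizes on
the double sample, shows that a count of mean at most `N` deviates by `O(√(N D) + D)`, where
`D = d log (2n / δ)`. The variance term scales with `N`, so the positive rate of a group of
probability at least `P₀` is estimated at the rate `√(D / (P₀ n))`.

The adversary moves at most `3αn/2 + O(D)` points. If `m₀` and `m₁` of them lie in the two groups,
whose unmarked parts have at least `P₀n/4` points each, the positive rates move by at most
`m₀ / (P₀n/4 + m₀) + m₁ / (P₀n/4 + m₁)`, which by concavity is largest for `m₀ = m₁` and then
equals `Δ^par` up to `O(D / (P₀ n))`. If `α ≥ P₀/3` or `D` is large, the bound on the parity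
deviation exceeds `1` and is trivial.
-/

namespace FairLearning

section HoldsUpTo

variable {Ω Ω' : Type*} [MeasurableSpace Ω] [MeasurableSpace Ω'] {μ : Measure Ω}

/-- `p` holds outside an event of probability at most `η`. The failure set is measured by the outer
measure, because a supremum over a hypothesis class need not be measurable. -/
def HoldsUpTo (μ : Measure Ω) (η : ℝ) (p : Ω → Prop) : Prop :=
  μ.real {ω | ¬ p ω} ≤ η

lemma HoldsUpTo.mono [IsFiniteMeasure μ] {η : ℝ} {p q : Ω → Prop} (hp : HoldsUpTo μ η p)
    (hpq : ∀ ω, p ω → q ω) : HoldsUpTo μ η q :=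
  (measureReal_mono fun ω (hω : ¬ q ω) (h : p ω) => hω (hpq ω h)).trans hp

lemma HoldsUpTo.of_ae {p : Ω → Prop} (hp : ∀ᵐ ω ∂μ, p ω) : HoldsUpTo μ 0 p := by
  rw [HoldsUpTo, measureReal_def, ae_iff.1 hp, ENNReal.toReal_zero]

lemma HoldsUpTo.and [IsFiniteMeasure μ] {η θ : ℝ} {p q : Ω → Prop} (hp : HoldsUpTo μ η p)
    (hq : HoldsUpTo μ θ q) : HoldsUpTo μ (η + θ) fun ω => p ω ∧ q ω := by
  have hsub : {ω | ¬ (p ω ∧ q ω)} ⊆ {ω | ¬ p ω} ∪ {ω | ¬ q ω} :=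
    fun _ hω => not_and_or.1 hω
  exact ((measureReal_mono hsub).trans (measureReal_union_le _ _)).trans (add_le_add hp hq)

lemma HoldsUpTo.of_map [IsFiniteMeasure μ] {η : ℝ} {f : Ω → Ω'} (hf : AEMeasurable f μ)
    {p : Ω' → Prop} (hp : HoldsUpTo (μ.map f) η p) : HoldsUpTo μ η fun ω => p (f ω) :=
  (ENNReal.toReal_mono (measure_ne_top _ _) (Measure.le_map_apply hf _)).trans hp

lemma HoldsUpTo.of_lintegral_le {G : Ω → ENNReal} (hG : AEMeasurable G μ) {B r : ℝ} (hB : 0 ≤ B)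
    (hr : 0 < r) (hGB : ∫⁻ ω, G ω ∂μ ≤ ENNReal.ofReal B) :
    HoldsUpTo μ (B / r) fun ω => G ω < ENNReal.ofReal r := by
  simp_rw [HoldsUpTo, not_lt]
  refine ENNReal.toReal_le_of_le_ofReal (by positivity) ?_
  rw [ENNReal.ofReal_div_of_pos hr]
  exact (meas_ge_le_lintegral_div hG (by simpa using hr) ENNReal.ofReal_ne_top).trans
    (ENNReal.div_le_div_right hGB _)

lemma HoldsUpTo.exists_measurableSet [IsProbabilityMeasure μ] {η δ : ℝ} (hηδ : η < δ)
    {p : Ω → Prop} (hp : HoldsUpTo μ η p) :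
    ∃ E : Set Ω, MeasurableSet E ∧ 1 - δ < μ.real E ∧ ∀ ω ∈ E, p ω := by
  refine ⟨(toMeasurable μ {ω | ¬ p ω})ᶜ, (measurableSet_toMeasurable _ _).compl, ?_, fun ω hω => ?_⟩
  · rw [probReal_compl_eq_one_sub (measurableSet_toMeasurable _ _), measureReal_def,
      measure_toMeasurable, ← measureReal_def]
    have : μ.real {ω | ¬ p ω} ≤ η := hp
    linarith
  · by_contra h
    exact hω (subset_toMeasurable _ _ h)

end HoldsUpTo

section Patterns

variable {X ι κ : Type*} {H : Set (X → Fin 2)} {d : ℕ}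

/-- Some hypothesis in `H` labels the points `x` by the pattern `b`. -/
def Realizes (H : Set (X → Fin 2)) (x : ι → X) (b : ι → Fin 2) : Prop :=
  ∃ h ∈ H, ∀ i, h (x i) = b i

lemma realizes_comp_equiv (x : ι → X) (b : ι → Fin 2) (e : κ ≃ ι) :
    Realizes H (x ∘ e) (b ∘ e) ↔ Realizes H x b :=
  exists_congr fun _ => and_congr_right fun _ => e.forall_congr_left.trans (by simp)

lemma Shatters.card_le (hd : vcDim H ≤ d) {s : Finset X} (hs : Shatters H s) : s.card ≤ d := by
  have h : (s.card : ℕ∞) ≤ vcDim H := le_iSup₂_of_le s hs le_rfl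
  exact_mod_cast h.trans hd

lemma eq_of_vcDim_eq_zero (hH : vcDim H = 0) {h h' : X → Fin 2} (hh : h ∈ H) (hh' : h' ∈ H) :
    h = h' := by
  by_contra hne
  obtain ⟨x, hx⟩ := Function.ne_iff.1 hne
  have hsh : Shatters H {x} := by
    intro t ht
    have hval : (h x = 1 ∧ h' x ≠ 1) ∨ (h' x = 1 ∧ h x ≠ 1) := by omega
    rcases Finset.subset_singleton_iff.1 ht with rfl | rfl <;>
      rcases hval with ⟨h1, h2⟩ | ⟨h1, h2⟩
    · exact ⟨h', hh', by simp [h2]⟩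
    · exact ⟨h, hh, by simp [h2]⟩
    · exact ⟨h, hh, by simp [h1]⟩
    · exact ⟨h', hh', by simp [h1]⟩
  simpa using Shatters.card_le (d := 0) hH.le hsh

lemma sum_choose_le_pow (m d : ℕ) :
    ∑ k ∈ Finset.range (d + 1), m.choose k ≤ (m + 1) ^ d := by
  induction d with
  | zero => simp
  | succ d ih =>
    have hlast : m.choose (d + 1) ≤ (m + 1) ^ d * m :=
      calc m.choose (d + 1) ≤ m ^ d * m := Nat.choose_le_pow _ _
        _ ≤ (m + 1) ^ d * m := by gcongr; omega
    calc ∑ k ∈ Finset.range (d + 2), m.choose k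
        ≤ (m + 1) ^ d + (m + 1) ^ d * m := by
          rw [Finset.sum_range_succ]
          exact add_le_add ih hlast
      _ = (m + 1) ^ (d + 1) := by ring

lemma shatters_image [DecidableEq X] {x : ι → X} {s : Finset ι}
    (hs : ∀ t ⊆ s, ∃ h ∈ H, ∀ i ∈ s, (h (x i) = 1 ↔ i ∈ t)) :
    Set.InjOn x s ∧ Shatters H (s.image x) := by
  classical
  refine ⟨fun i hi j hj hij => ?_, fun t _ => ?_⟩
  · obtain ⟨h, -, hh⟩ := hs {i} (by simpa using hi)
    have hj' : h (x j) = 1 := hij ▸ (hh i hi).2 (Finset.mem_singleton_self i)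
    exact (Finset.mem_singleton.1 ((hh j hj).1 hj')).symm
  · obtain ⟨h, hH, hh⟩ := hs {i ∈ s | x i ∈ t} (Finset.filter_subset _ _)
    refine ⟨h, hH, fun z hz => ?_⟩
    obtain ⟨i, hi, rfl⟩ := Finset.mem_image.1 hz
    rw [hh i hi, Finset.mem_filter, and_iff_right hi]

lemma card_realizes_le [Fintype ι] [DecidableEq ι] (hd : vcDim H ≤ d) (x : ι → X)
    [DecidablePred (Realizes H x)] :
    (Finset.univ.filter (Realizes H x)).card ≤ (Fintype.card ι + 1) ^ d := by
  classical
  set ones : (ι → Fin 2) → Finset ι := fun b => {i | b i = 1} with hones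
  have hinj : Function.Injective ones := fun b c hbc => funext fun i => by
    have : b i = 1 ↔ c i = 1 := by simpa [hones] using congrArg (i ∈ ·) hbc
    omega
  set 𝒜 : Finset (Finset ι) := (Finset.univ.filter (Realizes H x)).image ones
  have hshatter : 𝒜.vcDim ≤ d := by
    refine Finset.sup_le fun s hs => ?_
    have htrace : ∀ t ⊆ s, ∃ h ∈ H, ∀ i ∈ s, (h (x i) = 1 ↔ i ∈ t) := by
      intro t ht
      obtain ⟨u, hu, rfl⟩ := Finset.mem_shatterer.1 hs ht
      obtain ⟨b, hb, rfl⟩ := Finset.mem_image.1 hu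
      obtain ⟨h, hH, hhb⟩ := (Finset.mem_filter.1 hb).2
      exact ⟨h, hH, fun i hi => by simp [hones, hi, hhb]⟩
    obtain ⟨hx, himage⟩ := shatters_image htrace
    exact Finset.card_image_of_injOn hx ▸ himage.card_le hd
  calc (Finset.univ.filter (Realizes H x)).card = 𝒜.card :=
        (Finset.card_image_of_injective _ hinj).symm
    _ ≤ 𝒜.shatterer.card := 𝒜.card_le_card_shatterer
    _ ≤ ∑ k ∈ Finset.Iic 𝒜.vcDim, (Fintype.card ι).choose k :=
        Finset.card_shatterer_le_sum_vcDim
    _ ≤ ∑ k ∈ Finset.range (d + 1), (Fintype.card ι).choose k :=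
        Finset.sum_le_sum_of_subset fun k hk =>
          Finset.mem_range_succ_iff.2 ((Finset.mem_Iic.1 hk).trans hshatter)
    _ ≤ (Fintype.card ι + 1) ^ d := sum_choose_le_pow _ d

end Patterns

section Signs

variable {ι : Type*} [Fintype ι] [DecidableEq ι]

lemma sum_signs_exp (v : ι → ℝ) :
    ∑ σ : ι → Bool, Real.exp (∑ i, if σ i then -v i else v i) = ∏ i, (2 * Real.cosh (v i)) := by
  have hcosh : ∀ i, ∑ τ : Bool, Real.exp (if τ then -v i else v i) = 2 * Real.cosh (v i) := by
    intro i
    rw [Fintype.sum_bool, Real.cosh_eq]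
    simp only [if_true, Bool.false_eq_true, if_false]
    ring
  simp_rw [Real.exp_sum, ← hcosh, Finset.prod_univ_sum, Fintype.piFinset_univ]

lemma sum_signs_cosh_le (v : ι → ℝ) :
    ∑ σ : ι → Bool, Real.cosh (∑ i, if σ i then -v i else v i) ≤
      2 ^ Fintype.card ι * Real.exp (∑ i, v i ^ 2 / 2) := by
  have hneg : ∀ σ : ι → Bool, -∑ i, (if σ i then -v i else v i) =
      ∑ i, if σ i then -(-v) i else (-v) i := fun σ => by
    rw [← Finset.sum_neg_distrib]
    exact Finset.sum_congr rfl fun i _ => by split_ifs <;> rfl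
  calc ∑ σ : ι → Bool, Real.cosh (∑ i, if σ i then -v i else v i)
      = ∏ i, (2 * Real.cosh (v i)) := by
        simp_rw [Real.cosh_eq _, ← Finset.sum_div, Finset.sum_add_distrib, hneg, sum_signs_exp,
          Pi.neg_apply, Real.cosh_neg, add_self_div_two, Real.cosh_eq]
    _ ≤ ∏ i, (2 * Real.exp (v i ^ 2 / 2)) := by
        gcongr with i
        exact Real.cosh_le_exp_half_sq _
    _ = 2 ^ Fintype.card ι * Real.exp (∑ i, v i ^ 2 / 2) := by
        rw [Finset.prod_mul_distrib, Finset.prod_const, Finset.card_univ, Real.exp_sum]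

end Signs

section DoubleSample

variable {X Z ι : Type*}

/-- The permutation of the double sample `ι ⊕ ι` that exchanges the two copies of the indices
selected by `σ`. -/
def swapPerm (σ : ι → Bool) : Equiv.Perm (ι ⊕ ι) :=
  Function.Involutive.toPerm
    (Sum.elim (fun i => if σ i then .inr i else .inl i) fun i => if σ i then .inl i else .inr i)
    (by rintro (i | i) <;> by_cases h : σ i <;> simp [h])

@[simp] lemma swapPerm_inl (σ : ι → Bool) (i : ι) :
    swapPerm σ (.inl i) = if σ i then .inr i else .inl i := rfl

@[simp] lemma swapPerm_inr (σ : ι → Bool) (i : ι) :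
    swapPerm σ (.inr i) = if σ i then .inl i else .inr i := rfl

variable [Fintype ι]

/-- The difference between the total losses of the two halves of a double sample `z` whose points
have been given the labels `b`. -/
def lossGap (ℓ : Fin 2 → Z → ℝ) (b : ι ⊕ ι → Fin 2) (z : ι ⊕ ι → Z) : ℝ :=
  ∑ i, (ℓ (b (.inl i)) (z (.inl i)) - ℓ (b (.inr i)) (z (.inr i)))

lemma lossGap_swapPerm (ℓ : Fin 2 → Z → ℝ) (b : ι ⊕ ι → Fin 2) (z : ι ⊕ ι → Z) (σ : ι → Bool) :
    lossGap ℓ (b ∘ swapPerm σ) (z ∘ swapPerm σ) =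
      ∑ i, if σ i then -(ℓ (b (.inl i)) (z (.inl i)) - ℓ (b (.inr i)) (z (.inr i)))
        else ℓ (b (.inl i)) (z (.inl i)) - ℓ (b (.inr i)) (z (.inr i)) :=
  Finset.sum_congr rfl fun i _ => by by_cases h : σ i <;> simp [h]

variable [DecidableEq ι]

open Classical in
/-- The sum of `cosh (s * gap)` over the patterns that `H` realizes on a double sample: a
measurable upper bound for the exponential of the largest gap over `H`. -/
noncomputable def patternCosh (H : Set (X → Fin 2)) (x : Z → X) (ℓ : Fin 2 → Z → ℝ) (s : ℝ)
    (z : ι ⊕ ι → Z) : ENNReal :=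
  ∑ b : ι ⊕ ι → Fin 2,
    if Realizes H (x ∘ z) b then ENNReal.ofReal (Real.cosh (s * lossGap ℓ b z)) else 0

open Classical in
lemma patternCosh_comp_swapPerm (H : Set (X → Fin 2)) (x : Z → X) (ℓ : Fin 2 → Z → ℝ) (s : ℝ)
    (z : ι ⊕ ι → Z) (σ : ι → Bool) :
    patternCosh H x ℓ s (z ∘ swapPerm σ) = ∑ b : ι ⊕ ι → Fin 2, if Realizes H (x ∘ z) b then
      ENNReal.ofReal (Real.cosh (s * lossGap ℓ (b ∘ swapPerm σ) (z ∘ swapPerm σ))) else 0 := by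
  rw [patternCosh, ← Equiv.sum_comp ((swapPerm σ).symm.arrowCongr (Equiv.refl _))]
  refine Finset.sum_congr rfl fun b _ => ?_
  have hb : (swapPerm σ).symm.arrowCongr (Equiv.refl (Fin 2)) b = b ∘ swapPerm σ := rfl
  rw [hb, ← Function.comp_assoc, realizes_comp_equiv]

lemma exp_abs_mul_lossGap_le {H : Set (X → Fin 2)} {h : X → Fin 2} (hh : h ∈ H) (x : Z → X)
    (ℓ : Fin 2 → Z → ℝ) (s : ℝ) (z : ι ⊕ ι → Z) :
    ENNReal.ofReal (Real.exp |s * lossGap ℓ (h ∘ x ∘ z) z|) ≤ 2 * patternCosh H x ℓ s z := by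
  classical
  have hreal : Realizes H (x ∘ z) (h ∘ x ∘ z) := ⟨h, hh, fun _ => rfl⟩
  calc ENNReal.ofReal (Real.exp |s * lossGap ℓ (h ∘ x ∘ z) z|)
      ≤ ENNReal.ofReal (2 * Real.cosh (s * lossGap ℓ (h ∘ x ∘ z) z)) := by
        gcongr
        exact (Real.exp_abs_le _).trans_eq (by rw [Real.cosh_eq]; ring)
    _ = 2 * (if Realizes H (x ∘ z) (h ∘ x ∘ z) then
          ENNReal.ofReal (Real.cosh (s * lossGap ℓ (h ∘ x ∘ z) z)) else 0) := by
        rw [if_pos hreal, ENNReal.ofReal_mul (by norm_num), ENNReal.ofReal_ofNat]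
    _ ≤ 2 * patternCosh H x ℓ s z := by
        gcongr
        exact Finset.single_le_sum (f := fun b => if Realizes H (x ∘ z) b then
          ENNReal.ofReal (Real.cosh (s * lossGap ℓ b z)) else 0) (fun _ _ => zero_le)
          (Finset.mem_univ _)

/-- `ℓ c z`, the loss incurred by the label `c` at the point `z`, is at most `w z`. The mean of `w`
controls the variance of the loss, which makes deviation bounds scale with it. -/
structure IsEnvelope [MeasurableSpace Z] (ℓ : Fin 2 → Z → ℝ) (w : Z → ℝ) : Prop where
  measurable_loss : ∀ c, Measurable (ℓ c)
  measurable : Measurable w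
  loss_nonneg : ∀ c z, 0 ≤ ℓ c z
  loss_le : ∀ c z, ℓ c z ≤ w z
  le_one : ∀ z, w z ≤ 1

variable [MeasurableSpace Z] {ℓ : Fin 2 → Z → ℝ} {w : Z → ℝ}

lemma IsEnvelope.sum_cosh_lossGap_le (hw : IsEnvelope ℓ w) (b : ι ⊕ ι → Fin 2) (s : ℝ)
    (z : ι ⊕ ι → Z) :
    ∑ σ : ι → Bool, Real.cosh (s * lossGap ℓ (b ∘ swapPerm σ) (z ∘ swapPerm σ)) ≤
      2 ^ Fintype.card ι * Real.exp (∑ k, s ^ 2 / 2 * w (z k)) := by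
  have hsq : ∀ c c' u u', (ℓ c u - ℓ c' u') ^ 2 ≤ w u + w u' := by
    intro c c' u u'
    nlinarith [hw.loss_nonneg c u, hw.loss_nonneg c' u', hw.loss_le c u, hw.loss_le c' u',
      hw.le_one u, hw.le_one u']
  simp_rw [lossGap_swapPerm, Finset.mul_sum, mul_ite, mul_neg]
  refine (sum_signs_cosh_le _).trans ?_
  rw [Fintype.sum_sum_type, ← Finset.sum_add_distrib]
  gcongr with i
  rw [mul_pow, mul_div_right_comm, ← mul_add]
  gcongr
  exact hsq _ _ _ _

lemma IsEnvelope.sum_patternCosh_le {H : Set (X → Fin 2)} {d : ℕ} (hd : vcDim H ≤ d)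
    (hw : IsEnvelope ℓ w) (x : Z → X) (s : ℝ) (z : ι ⊕ ι → Z) :
    ∑ σ : ι → Bool, patternCosh H x ℓ s (z ∘ swapPerm σ) ≤
      2 ^ Fintype.card ι * ((2 * Fintype.card ι + 1) ^ d *
        ENNReal.ofReal (Real.exp (∑ k, s ^ 2 / 2 * w (z k)))) := by
  classical
  simp_rw [patternCosh_comp_swapPerm]
  rw [Finset.sum_comm]
  calc _ ≤ ∑ b : ι ⊕ ι → Fin 2, if Realizes H (x ∘ z) b then
        2 ^ Fintype.card ι * ENNReal.ofReal (Real.exp (∑ k, s ^ 2 / 2 * w (z k))) else 0 := by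
        refine Finset.sum_le_sum fun b _ => ?_
        split_ifs
        · rw [← ENNReal.ofReal_sum_of_nonneg fun _ _ => (Real.cosh_pos _).le]
          refine (ENNReal.ofReal_le_ofReal (hw.sum_cosh_lossGap_le b s z)).trans_eq ?_
          rw [ENNReal.ofReal_mul (by positivity), ENNReal.ofReal_pow (by norm_num),
            ENNReal.ofReal_ofNat]
        · simp
    _ = (Finset.univ.filter (Realizes H (x ∘ z))).card *
          (2 ^ Fintype.card ι * ENNReal.ofReal (Real.exp (∑ k, s ^ 2 / 2 * w (z k)))) := by
        rw [← Finset.sum_filter, Finset.sum_const, nsmul_eq_mul]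
    _ ≤ (2 * Fintype.card ι + 1) ^ d *
          (2 ^ Fintype.card ι * ENNReal.ofReal (Real.exp (∑ k, s ^ 2 / 2 * w (z k)))) := by
        gcongr
        have := card_realizes_le hd (x ∘ z)
        rw [Fintype.card_sum, ← two_mul] at this
        exact_mod_cast this
    _ = _ := mul_left_comm _ _ _

end DoubleSample

lemma exp_mul_abs_sub_integral_le {Ω : Type*} [MeasurableSpace Ω] {μ : Measure Ω}
    [IsProbabilityMeasure μ] {V : Ω → ℝ} {s : ℝ} (hs : 0 ≤ s) (hV : Integrable V μ) (a : ℝ) :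
    ENNReal.ofReal (Real.exp (s * |a - ∫ ω, V ω ∂μ|)) ≤
      ∫⁻ ω, ENNReal.ofReal (Real.exp (s * |a - V ω|)) ∂μ := by
  have hint : Integrable (fun ω => a - V ω) μ := (integrable_const a).sub hV
  have hmeas : AEStronglyMeasurable (fun ω => Real.exp (s * |a - V ω|)) μ :=
    Real.continuous_exp.comp_aestronglyMeasurable (hint.abs.const_mul s).aestronglyMeasurable
  have hnonneg : 0 ≤ᵐ[μ] fun ω => Real.exp (s * |a - V ω|) :=
    .of_forall fun _ => (Real.exp_pos _).le
  by_cases hexp : Integrable (fun ω => Real.exp (s * |a - V ω|)) μ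
  · rw [← ofReal_integral_eq_lintegral_ofReal hexp hnonneg]
    gcongr
    calc Real.exp (s * |a - ∫ ω, V ω ∂μ|) = Real.exp (s * |∫ ω, (a - V ω) ∂μ|) := by
          rw [integral_sub (integrable_const a) hV]
          simp only [integral_const, probReal_univ, smul_eq_mul, one_mul]
      _ ≤ Real.exp (∫ ω, s * |a - V ω| ∂μ) := by
          rw [integral_const_mul]
          gcongr
          exact abs_integral_le_integral_abs
      _ ≤ ∫ ω, Real.exp (s * |a - V ω|) ∂μ :=
          convexOn_exp.map_integral_le Real.continuous_exp.continuousOn isClosed_univ (by simp)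
            (hint.abs.const_mul s) hexp
  · rw [not_ne_iff.1 (mt (lintegral_ofReal_ne_top_iff_integrable hmeas hnonneg).1 hexp)]
    exact le_top

section Symmetrization

variable {X Z ι κ : Type*} [MeasurableSpace X] [MeasurableSpace Z] [Fintype ι] [Fintype κ]
  {H : Set (X → Fin 2)} {d : ℕ} {ν : Measure Z} [IsProbabilityMeasure ν] {x : Z → X}
  {ℓ : Fin 2 → Z → ℝ} {w : Z → ℝ}

lemma measurePreserving_comp_equiv (ν : Measure Z) [SigmaFinite ν] (e : κ ≃ ι) :
    MeasurePreserving (fun z : ι → Z => z ∘ e) (Measure.pi fun _ => ν) (Measure.pi fun _ => ν) :=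
  (measurePreserving_piCongrLeft (fun _ => ν) e).symm _

lemma MeasurableClass.nullMeasurableSet_realizes (hx : Measurable x)
    (hH : MeasurableClass H (ν.map x)) (b : κ → Fin 2) :
    NullMeasurableSet {z : κ → Z | Realizes H (x ∘ z) b} (Measure.pi fun _ => ν) := by
  have : IsProbabilityMeasure (ν.map x) := Measure.isProbabilityMeasure_map hx.aemeasurable
  set e := (Fintype.equivFin κ).symm
  have hpres : MeasurePreserving (fun z : κ → Z => x ∘ z ∘ e) (Measure.pi fun _ => ν)
      (Measure.pi fun _ => ν.map x) :=
    (measurePreserving_pi (fun _ => ν) (fun _ => ν.map x) fun _ => ⟨hx, rfl⟩).comp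
      (measurePreserving_comp_equiv ν e)
  have hset : {z : κ → Z | Realizes H (x ∘ z) b} =
      (fun z : κ → Z => x ∘ z ∘ e) ⁻¹' {u | Realizes H u (b ∘ e)} :=
    Set.ext fun z => (realizes_comp_equiv (x ∘ z) b e).symm
  rw [hset]
  exact (hH.pattern _ (b ∘ e)).preimage hpres.quasiMeasurePreserving

lemma IsEnvelope.nonneg (hw : IsEnvelope ℓ w) (z : Z) : 0 ≤ w z :=
  (hw.loss_nonneg 0 z).trans (hw.loss_le 0 z)

lemma IsEnvelope.integrable (hw : IsEnvelope ℓ w) : Integrable w ν :=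
  .of_bound hw.measurable.aestronglyMeasurable 1 <| .of_forall fun z => by
    rw [Real.norm_of_nonneg (hw.nonneg z)]
    exact hw.le_one z

lemma IsEnvelope.integrable_loss (hw : IsEnvelope ℓ w) {c : Z → Fin 2} (hc : Measurable c) :
    Integrable (fun z => ℓ (c z) z) ν := by
  have hmeas : Measurable fun z => ℓ (c z) z :=
    (measurable_from_prod_countable_right (f := fun q : Fin 2 × Z => ℓ q.1 q.2)
      hw.measurable_loss).comp (hc.prodMk measurable_id)
  refine hw.integrable.mono hmeas.aestronglyMeasurable (.of_forall fun z => ?_)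
  rw [Real.norm_of_nonneg (hw.loss_nonneg _ _), Real.norm_of_nonneg (hw.nonneg z)]
  exact hw.loss_le _ _

lemma IsEnvelope.integrable_exp (hw : IsEnvelope ℓ w) {c : ℝ} (hc : 0 ≤ c) :
    Integrable (fun z => Real.exp (c * w z)) ν := by
  refine .of_bound (Real.measurable_exp.comp (hw.measurable.const_mul c)).aestronglyMeasurable
    (Real.exp (c * 1)) <| .of_forall fun z => ?_
  rw [Real.norm_eq_abs, Real.abs_exp]
  gcongr
  exact hw.le_one z

lemma IsEnvelope.integral_exp_le (hw : IsEnvelope ℓ w) {c : ℝ} (hc0 : 0 ≤ c) (hc1 : c ≤ 1) :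
    ∫ z, Real.exp (c * w z) ∂ν ≤ Real.exp (2 * c * ∫ z, w z ∂ν) := by
  have hpoint : ∀ z, Real.exp (c * w z) ≤ 1 + 2 * c * w z := by
    intro z
    have h0 : 0 ≤ c * w z := mul_nonneg hc0 (hw.nonneg z)
    have h1 : c * w z ≤ 1 := mul_le_one₀ hc1 (hw.nonneg z) (hw.le_one z)
    have := Real.abs_exp_sub_one_le (abs_le.2 ⟨by linarith, h1⟩)
    rw [abs_of_nonneg h0] at this
    linarith [le_abs_self (Real.exp (c * w z) - 1)]
  have hint : Integrable (fun z => 2 * c * w z) ν := hw.integrable.const_mul _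
  calc ∫ z, Real.exp (c * w z) ∂ν ≤ ∫ z, (1 + 2 * c * w z) ∂ν :=
        integral_mono (hw.integrable_exp hc0) ((integrable_const _).add hint) hpoint
    _ = 1 + 2 * c * ∫ z, w z ∂ν := by
        rw [integral_add (integrable_const _) hint, integral_const_mul]
        simp only [integral_const, probReal_univ, smul_eq_mul, mul_one]
    _ ≤ Real.exp (2 * c * ∫ z, w z ∂ν) := by
        linarith [Real.add_one_le_exp (2 * c * ∫ z, w z ∂ν)]

lemma IsEnvelope.lintegral_exp_sum_le (hw : IsEnvelope ℓ w) {c : ℝ} (hc0 : 0 ≤ c) (hc1 : c ≤ 1) :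
    ∫⁻ z : κ → Z, ENNReal.ofReal (Real.exp (∑ k, c * w (z k))) ∂(Measure.pi fun _ => ν) ≤
      ENNReal.ofReal (Real.exp (2 * c * Fintype.card κ * ∫ z, w z ∂ν)) := by
  simp_rw [Real.exp_sum]
  rw [← ofReal_integral_eq_lintegral_ofReal
    (Integrable.fintype_prod fun _ => hw.integrable_exp hc0)
    (.of_forall fun z => Finset.prod_nonneg fun k _ => (Real.exp_pos _).le),
    integral_fintype_prod_eq_pow (fun u => Real.exp (c * w u))]
  gcongr
  calc (∫ u, Real.exp (c * w u) ∂ν) ^ Fintype.card κ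
      ≤ Real.exp (2 * c * ∫ u, w u ∂ν) ^ Fintype.card κ := by
        have : 0 ≤ ∫ u, Real.exp (c * w u) ∂ν := integral_nonneg fun u => (Real.exp_pos _).le
        gcongr
        exact hw.integral_exp_le hc0 hc1
    _ = Real.exp (2 * c * Fintype.card κ * ∫ u, w u ∂ν) := by
        rw [← Real.exp_nat_mul]
        ring_nf

lemma IsEnvelope.aemeasurable_patternCosh [DecidableEq ι] (hw : IsEnvelope ℓ w) (hx : Measurable x)
    (hH : MeasurableClass H (ν.map x)) (s : ℝ) :
    AEMeasurable (patternCosh (ι := ι) H x ℓ s) (Measure.pi fun _ => ν) := by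
  classical
  refine Finset.aemeasurable_fun_sum _ fun b _ => ?_
  have hgap : Measurable fun z : ι ⊕ ι → Z => lossGap ℓ b z := by
    have := hw.measurable_loss
    unfold lossGap
    fun_prop
  have hcosh : Measurable fun z : ι ⊕ ι → Z => ENNReal.ofReal (Real.cosh (s * lossGap ℓ b z)) :=
    (Real.continuous_cosh.measurable.comp (hgap.const_mul s)).ennreal_ofReal
  convert hcosh.aemeasurable.indicator₀ (hH.nullMeasurableSet_realizes hx b) using 1
  funext z
  simp only [Set.indicator_apply, Set.mem_ofPred_eq]

lemma IsEnvelope.lintegral_patternCosh_le [DecidableEq ι] (hd : vcDim H ≤ d)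
    (hw : IsEnvelope ℓ w) (hx : Measurable x) (hH : MeasurableClass H (ν.map x)) {s : ℝ}
    (hs : s ^ 2 ≤ 1) :
    ∫⁻ z : ι ⊕ ι → Z, patternCosh H x ℓ s z ∂(Measure.pi fun _ => ν) ≤
      (2 * Fintype.card ι + 1) ^ d * ENNReal.ofReal
        (Real.exp (2 * s ^ 2 * Fintype.card ι * ∫ z, w z ∂ν)) := by
  have hmeas := hw.aemeasurable_patternCosh (ι := ι) hx hH s
  have hswap : ∀ σ : ι → Bool,
      MeasurePreserving (fun z : ι ⊕ ι → Z => z ∘ swapPerm σ) (Measure.pi fun _ => ν)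
        (Measure.pi fun _ => ν) := fun σ => measurePreserving_comp_equiv ν (swapPerm σ)
  have hinv : ∀ σ : ι → Bool,
      ∫⁻ z : ι ⊕ ι → Z, patternCosh H x ℓ s (z ∘ swapPerm σ) ∂(Measure.pi fun _ => ν) =
        ∫⁻ z : ι ⊕ ι → Z, patternCosh H x ℓ s z ∂(Measure.pi fun _ => ν) := fun σ => by
    conv_rhs => rw [← (hswap σ).map_eq]
    rw [lintegral_map' (by rwa [(hswap σ).map_eq]) (hswap σ).aemeasurable]
  refine (ENNReal.mul_le_mul_iff_right (a := 2 ^ Fintype.card ι) (by simp) (by simp)).1 ?_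
  calc 2 ^ Fintype.card ι * ∫⁻ z : ι ⊕ ι → Z, patternCosh H x ℓ s z ∂(Measure.pi fun _ => ν)
      = ∫⁻ z : ι ⊕ ι → Z, ∑ σ : ι → Bool, patternCosh H x ℓ s (z ∘ swapPerm σ)
          ∂(Measure.pi fun _ => ν) := by
        rw [lintegral_finsetSum' (f := fun σ z => patternCosh H x ℓ s (z ∘ swapPerm σ)) _
          fun σ _ => hmeas.comp_quasiMeasurePreserving (hswap σ).quasiMeasurePreserving]
        simp [hinv]
    _ ≤ ∫⁻ z : ι ⊕ ι → Z, 2 ^ Fintype.card ι * ((2 * Fintype.card ι + 1) ^ d *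
          ENNReal.ofReal (Real.exp (∑ k, s ^ 2 / 2 * w (z k)))) ∂(Measure.pi fun _ => ν) :=
        lintegral_mono fun z => hw.sum_patternCosh_le hd x s z
    _ = 2 ^ Fintype.card ι * ((2 * Fintype.card ι + 1) ^ d *
          ∫⁻ z : ι ⊕ ι → Z, ENNReal.ofReal (Real.exp (∑ k, s ^ 2 / 2 * w (z k)))
            ∂(Measure.pi fun _ => ν)) := by
        rw [lintegral_const_mul' _ _ (by simp), lintegral_const_mul' _ _ (by finiteness)]
    _ ≤ _ := by
        gcongr
        refine (hw.lintegral_exp_sum_le (by positivity) (by linarith)).trans_eq ?_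
        rw [Fintype.card_sum]
        push_cast
        ring_nf

lemma IsEnvelope.exp_deviation_le_lintegral [DecidableEq ι] (hw : IsEnvelope ℓ w)
    (hx : Measurable x) {s : ℝ} (hs : 0 ≤ s) {h : X → Fin 2} (hh : h ∈ H) (hm : Measurable h)
    (z : ι → Z) :
    ENNReal.ofReal (Real.exp
        (s * |∑ i, ℓ (h (x (z i))) (z i) - Fintype.card ι * ∫ u, ℓ (h (x u)) u ∂ν|)) ≤
      2 * ∫⁻ z', patternCosh H x ℓ s (Sum.elim z z') ∂(Measure.pi fun _ : ι => ν) := by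
  set g : Z → ℝ := fun u => ℓ (h (x u)) u
  have hg : Integrable g ν := hw.integrable_loss (hm.comp hx)
  have hgi : ∀ i : ι, Integrable (fun z' : ι → Z => g (z' i)) (Measure.pi fun _ => ν) :=
    fun _ => integrable_comp_eval hg
  have hmean : ∫ z' : ι → Z, ∑ i, g (z' i) ∂(Measure.pi fun _ => ν) =
      Fintype.card ι * ∫ u, g u ∂ν := by
    rw [integral_finsetSum _ fun i _ => hgi i]
    simp_rw [integral_comp_eval (μ := fun _ : ι => ν) hg.aestronglyMeasurable]
    rw [Finset.sum_const, Finset.card_univ, nsmul_eq_mul]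
  rw [← hmean, ← lintegral_const_mul' _ _ (by simp)]
  refine (exp_mul_abs_sub_integral_le hs (integrable_finsetSum _ fun i _ => hgi i) _).trans
    (lintegral_mono fun z' => ?_)
  rw [← abs_of_nonneg hs, ← abs_mul, abs_of_nonneg hs, ← Finset.sum_sub_distrib]
  exact exp_abs_mul_lossGap_le hh x ℓ s (Sum.elim z z')

lemma IsEnvelope.aemeasurable_patternCosh_sumElim [DecidableEq ι] (hw : IsEnvelope ℓ w)
    (hx : Measurable x) (hH : MeasurableClass H (ν.map x)) (s : ℝ) :
    AEMeasurable (fun q : (ι → Z) × (ι → Z) => patternCosh H x ℓ s (Sum.elim q.1 q.2))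
      ((Measure.pi fun _ => ν).prod (Measure.pi fun _ => ν)) :=
  (hw.aemeasurable_patternCosh hx hH s).comp_quasiMeasurePreserving
    (measurePreserving_sumPiEquivProdPi_symm fun _ : ι ⊕ ι => ν).quasiMeasurePreserving

lemma IsEnvelope.lintegral_lintegral_patternCosh_le [DecidableEq ι] (hd : vcDim H ≤ d)
    (hw : IsEnvelope ℓ w) (hx : Measurable x) (hH : MeasurableClass H (ν.map x)) {s : ℝ}
    (hs : s ^ 2 ≤ 1) :
    ∫⁻ z : ι → Z, ∫⁻ z', patternCosh H x ℓ s (Sum.elim z z')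
        ∂(Measure.pi fun _ => ν) ∂(Measure.pi fun _ => ν) ≤
      (2 * Fintype.card ι + 1) ^ d * ENNReal.ofReal
        (Real.exp (2 * s ^ 2 * Fintype.card ι * ∫ z, w z ∂ν)) := by
  have hsplit := measurePreserving_sumPiEquivProdPi_symm fun _ : ι ⊕ ι => ν
  have hcosh := hw.aemeasurable_patternCosh (ι := ι) hx hH s
  rw [← lintegral_prod _ (hw.aemeasurable_patternCosh_sumElim hx hH s)]
  refine le_of_eq_of_le ?_ (hw.lintegral_patternCosh_le hd hx hH hs)
  rw [← hsplit.map_eq, lintegral_map' (by rwa [hsplit.map_eq]) hsplit.aemeasurable]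
  rfl

theorem IsEnvelope.holdsUpTo_deviation_lt (hd : vcDim H ≤ d) (hw : IsEnvelope ℓ w)
    (hx : Measurable x) (hH : MeasurableClass H (ν.map x)) {s : ℝ} (hs0 : 0 ≤ s) (hs1 : s ≤ 1)
    (t : ℝ) :
    HoldsUpTo (Measure.pi fun _ : ι => ν)
      (2 * (2 * Fintype.card ι + 1) ^ d *
        Real.exp (2 * s ^ 2 * Fintype.card ι * ∫ z, w z ∂ν - s * t))
      fun z => ∀ h ∈ H,
        |∑ i, ℓ (h (x (z i))) (z i) - Fintype.card ι * ∫ u, ℓ (h (x u)) u ∂ν| < t := by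
  classical
  have hmeas := (hw.aemeasurable_patternCosh_sumElim (ι := ι) hx hH s).lintegral_prod_right'
  have hbound : ∫⁻ z : ι → Z, 2 * ∫⁻ z', patternCosh H x ℓ s (Sum.elim z z')
        ∂(Measure.pi fun _ => ν) ∂(Measure.pi fun _ => ν) ≤
      ENNReal.ofReal (2 * (2 * Fintype.card ι + 1) ^ d *
        Real.exp (2 * s ^ 2 * Fintype.card ι * ∫ z, w z ∂ν)) := by
    rw [lintegral_const_mul' _ _ (by simp), mul_assoc (2 : ℝ), ENNReal.ofReal_mul (by norm_num),
      ENNReal.ofReal_mul (by positivity), ENNReal.ofReal_pow (by positivity), ENNReal.ofReal_ofNat]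
    gcongr
    exact_mod_cast hw.lintegral_lintegral_patternCosh_le hd hx hH (pow_le_one₀ hs0 hs1)
  rw [Real.exp_sub, ← mul_div_assoc]
  refine (HoldsUpTo.of_lintegral_le (hmeas.const_mul 2) (by positivity) (Real.exp_pos _)
    hbound).mono fun z hz h hh => ?_
  have hlt := (hw.exp_deviation_le_lintegral hx hs0 hh (hH.measurable h hh) z).trans_lt hz
  exact lt_of_mul_lt_mul_left (Real.exp_lt_exp.1 (ENNReal.ofReal_lt_ofReal_iff'.1 hlt).1) hs0

end Symmetrization

section Calibration

/-- The complexity term `d log (2n / δ)` in which all deviations are measured: a class of VC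
dimension at most `d` realizes so few patterns on a double sample of size `n` that a union bound
over them costs a multiple of it. -/
noncomputable def vcComplexity (d n : ℕ) (δ : ℝ) : ℝ := d * Real.log (2 * n / δ)

/-- The radius of Bernstein's inequality for a sum of nonnegative terms bounded by `1` of total mean
at most `N`, with exponent `D`: a variance term plus a range term. The factor `8` leaves the room
that symmetrization and the union bound over patterns take. -/
noncomputable def bernsteinRadius (N D : ℝ) : ℝ := 8 * (√(N * D) + D)

lemma vcComplexity_pos {d n : ℕ} (hd : 1 ≤ d) (hn : 1 ≤ n) {δ : ℝ} (hδ0 : 0 < δ) (hδ1 : δ ≤ 1) :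
    0 < vcComplexity d n δ := by
  have hn' : (1 : ℝ) ≤ n := mod_cast hn
  refine mul_pos (by positivity) (Real.log_pos ?_)
  rw [lt_div_iff₀ hδ0]
  linarith

lemma growth_mul_exp_neg_vcComplexity_le {d n : ℕ} (hd : 1 ≤ d) (hn : 1 ≤ n) {δ : ℝ} (hδ0 : 0 < δ)
    (hδ1 : δ ≤ 1) :
    2 * (2 * n + 1) ^ d * Real.exp (-(6 * vcComplexity d n δ)) ≤ δ / 8 := by
  have hn' : (1 : ℝ) ≤ n := mod_cast hn
  set q : ℝ := δ / (2 * n) with hq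
  have hq0 : 0 < q := by positivity
  have hqn : 2 * n * q = δ := by rw [hq]; field_simp
  have hq1 : q ≤ 1 / 2 := by nlinarith
  have hexp : Real.exp (-(6 * vcComplexity d n δ)) = (q ^ 6) ^ d := by
    rw [← Real.exp_log hq0, hq, ← inv_div (2 * (n : ℝ)) δ, Real.log_inv, ← Real.exp_nat_mul,
      ← Real.exp_nat_mul, vcComplexity]
    push_cast
    ring_nf
  have hbase : (2 * n + 1) * q ^ 6 ≤ q / 8 := by
    have h4 : q ^ 4 ≤ (1 / 2) ^ 4 := by gcongr
    calc (2 * n + 1) * q ^ 6 = (2 * n * q + q) * q ^ 4 * q := by ring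
      _ ≤ 3 / 2 * (1 / 2) ^ 4 * q := by
        gcongr
        linarith
      _ ≤ _ := by linarith
  calc 2 * (2 * n + 1) ^ d * Real.exp (-(6 * vcComplexity d n δ))
      = 2 * ((2 * n + 1) * q ^ 6) ^ d := by rw [hexp, mul_pow, mul_assoc]
    _ ≤ 2 * ((2 * n + 1) * q ^ 6) := by
        gcongr
        exact pow_le_of_le_one (by positivity) (by linarith) (by omega)
    _ ≤ δ / 8 := by nlinarith

lemma exists_scale_le_bernsteinRadius (N : ℝ) {D : ℝ} (hD : 0 ≤ D) :
    ∃ s : ℝ, 0 ≤ s ∧ s ≤ 1 ∧ 2 * s ^ 2 * N - s * bernsteinRadius N D ≤ -(6 * D) := by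
  have hroot := Real.sqrt_nonneg (N * D)
  unfold bernsteinRadius
  rcases le_or_gt N D with hND | hND
  · exact ⟨1, zero_le_one, le_rfl, by linarith⟩
  · have hN' : 0 < N := hD.trans_lt hND
    have hsq : √(D / N) ^ 2 * N = D := by rw [Real.sq_sqrt (by positivity)]; field_simp
    have hmul : √(D / N) * √(N * D) = D := by
      rw [← Real.sqrt_mul (by positivity), show D / N * (N * D) = D ^ 2 by field_simp,
        Real.sqrt_sq hD]
    refine ⟨√(D / N), Real.sqrt_nonneg _, Real.sqrt_le_one.2 ?_, ?_⟩
    · exact (div_le_one hN').2 hND.le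
    · nlinarith [mul_nonneg (Real.sqrt_nonneg (D / N)) hD]

variable {X Z : Type*} [MeasurableSpace X] [MeasurableSpace Z] {H : Set (X → Fin 2)} {d n : ℕ}
  {δ : ℝ} {ν : Measure Z} [IsProbabilityMeasure ν] {x : Z → X}

lemma IsEnvelope.holdsUpTo_deviation_le_bernsteinRadius {ℓ : Fin 2 → Z → ℝ} {w : Z → ℝ}
    (hw : IsEnvelope ℓ w) (hd : vcDim H ≤ d) (hd1 : 1 ≤ d) (hx : Measurable x)
    (hH : MeasurableClass H (ν.map x)) (hn : 1 ≤ n) (hδ0 : 0 < δ) (hδ1 : δ ≤ 1) :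
    HoldsUpTo (Measure.pi fun _ : Fin n => ν) (δ / 8) fun z => ∀ h ∈ H,
      |∑ i, ℓ (h (x (z i))) (z i) - n * ∫ u, ℓ (h (x u)) u ∂ν| ≤
        bernsteinRadius (n * ∫ u, w u ∂ν) (vcComplexity d n δ) := by
  obtain ⟨s, hs0, hs1, hs⟩ := exists_scale_le_bernsteinRadius (n * ∫ u, w u ∂ν)
    (vcComplexity_pos hd1 hn hδ0 hδ1).le
  have hdev := hw.holdsUpTo_deviation_lt (ι := Fin n) hd hx hH hs0 hs1
    (bernsteinRadius (n * ∫ u, w u ∂ν) (vcComplexity d n δ))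
  rw [Fintype.card_fin] at hdev
  refine le_trans (hdev.mono fun z hz h hh => (hz h hh).le) ?_
  refine le_trans ?_ (growth_mul_exp_neg_vcComplexity_le hd1 hn hδ0 hδ1)
  gcongr
  linarith

lemma holdsUpTo_card_deviation_le_bernsteinRadius {p : Fin 2 → Z → Prop}
    [∀ c, DecidablePred (p c)] {W : Set Z} (hp : ∀ c, MeasurableSet {u | p c u})
    (hW : MeasurableSet W) (hpW : ∀ c, {u | p c u} ⊆ W) (hd : vcDim H ≤ d) (hd1 : 1 ≤ d)
    (hx : Measurable x) (hH : MeasurableClass H (ν.map x)) (hn : 1 ≤ n) (hδ0 : 0 < δ)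
    (hδ1 : δ ≤ 1) :
    HoldsUpTo (Measure.pi fun _ : Fin n => ν) (δ / 8) fun z => ∀ h ∈ H,
      |((Finset.univ.filter fun i => p (h (x (z i))) (z i)).card : ℝ) -
          n * ν.real {u | p (h (x u)) u}| ≤
        bernsteinRadius (n * ν.real W) (vcComplexity d n δ) := by
  have hw : IsEnvelope (fun c => {u | p c u}.indicator 1) (W.indicator 1) :=
    { measurable_loss := fun c => measurable_one.indicator (hp c)
      measurable := measurable_one.indicator hW
      loss_nonneg := fun c => Set.indicator_nonneg fun _ _ => zero_le_one
      loss_le := fun c => Set.indicator_le_indicator_of_subset (hpW c) fun _ => zero_le_one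
      le_one := fun u => Set.indicator_le' (fun _ _ => le_rfl) (fun _ _ => zero_le_one) u }
  refine (hw.holdsUpTo_deviation_le_bernsteinRadius hd hd1 hx hH hn hδ0 hδ1).mono
    fun z hz h hh => ?_
  have hset : {u | p (h (x u)) u} = ⋃ c, {u | h (x u) = c} ∩ {u | p c u} := by ext; simp
  have hmeas : MeasurableSet {u | p (h (x u)) u} := hset ▸ .iUnion fun c =>
    ((hH.measurable h hh).comp hx (measurableSet_singleton c)).inter (hp c)
  have hint : ∫ u, {v | p (h (x u)) v}.indicator 1 u ∂ν = ν.real {u | p (h (x u)) u} :=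
    integral_indicator_one hmeas
  have hsum : ∑ i, {u | p (h (x (z i))) u}.indicator 1 (z i) =
      ((Finset.univ.filter fun i => p (h (x (z i))) (z i)).card : ℝ) := by
    simp only [Set.indicator_apply, Set.mem_ofPred_eq, Pi.one_apply, Finset.sum_boole]
  rw [← hint, ← hsum, ← integral_indicator_one hW]
  exact hz h hh

end Calibration

section Sampling

variable {X : Type*} {n : ℕ}

/-- The number of unmarked points of group `a`, on which the clean and the corrupted datasets
agree. -/
def unmarkedCount (S : Dataset X n) (m : Fin n → Bool) (a : Fin 2) : ℕ :=
  (Finset.univ.filter fun i => (S i).2.1 = a ∧ m i = false).card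

/-- The number of unmarked points of group `a` that `h` maps to `1`. -/
def unmarkedPositives (S : Dataset X n) (m : Fin n → Bool) (h : X → Fin 2) (a : Fin 2) : ℕ :=
  (Finset.univ.filter fun i => h (S i).1 = 1 ∧ (S i).2.1 = a ∧ m i = false).card

variable [MeasurableSpace X]

/-- For the hypothesis `h`, all counts in the clean dataset `S` with marks `m` that the analysis
uses are within their Bernstein radii of their means. -/
structure IsRepresentative (P : Measure (DataPoint X)) (α D : ℝ) (S : Dataset X n)
    (m : Fin n → Bool) (h : X → Fin 2) : Prop where
  marked : |((Finset.univ.filter fun i => m i = true).card : ℝ) - n * α| ≤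
    bernsteinRadius (n * α) D
  errors : |((Finset.univ.filter fun i => h (S i).1 ≠ (S i).2.2).card : ℝ) - n * risk P h| ≤
    bernsteinRadius n D
  count : ∀ a, |(unmarkedCount S m a : ℝ) - n * (groupProb P a * (1 - α))| ≤
    bernsteinRadius (n * (groupProb P a * (1 - α))) D
  positives : ∀ a,
    |(unmarkedPositives S m h a : ℝ) - n * (groupProb P a * positiveRate P h a * (1 - α))| ≤
      bernsteinRadius (n * (groupProb P a * (1 - α))) D

lemma measurableSet_group (a : Fin 2) : MeasurableSet {z : DataPoint X | z.2.1 = a} :=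
  (measurable_fst.comp measurable_snd) (measurableSet_singleton a)

variable {P : Measure (DataPoint X)}

lemma groupProb_mul_positiveRate [IsFiniteMeasure P] (h : X → Fin 2) (a : Fin 2) :
    groupProb P a * positiveRate P h a = P.real {z | h z.1 = 1 ∧ z.2.1 = a} := by
  rw [mul_comm, groupProb, positiveRate, measureReal_def, measureReal_def, measureReal_def,
    ← ENNReal.toReal_mul, cond_mul_eq_inter (measurableSet_group a), Set.inter_comm]
  rfl

variable [IsProbabilityMeasure P] {H : Set (X → Fin 2)} {d : ℕ} {α δ : ℝ} {β : Measure Bool}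
  [IsProbabilityMeasure β]

lemma real_singleton_false (hβ : β.real {true} = α) : β.real {false} = 1 - α := by
  rw [← hβ, ← probReal_compl_eq_one_sub (measurableSet_singleton true)]
  congr 1
  ext b
  cases b <;> simp

lemma holdsUpTo_marked_card_deviation {p : Fin 2 → DataPoint X → Prop}
    [∀ c, DecidablePred (p c)] {W : Set (DataPoint X)} (B : Finset Bool)
    (hp : ∀ c, MeasurableSet {v | p c v}) (hW : MeasurableSet W) (hpW : ∀ c, {v | p c v} ⊆ W)
    (hd : vcDim H ≤ d) (hd1 : 1 ≤ d) (hH : MeasurableClass H (P.map Prod.fst)) (hn : 1 ≤ n)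
    (hδ0 : 0 < δ) (hδ1 : δ ≤ 1) :
    HoldsUpTo (Measure.pi fun _ : Fin n => P.prod β) (δ / 8) fun z => ∀ h ∈ H,
      |((Finset.univ.filter fun i => p (h (z i).1.1) (z i).1 ∧ (z i).2 ∈ B).card : ℝ) -
          n * (P.real {v | p (h v.1) v} * β.real B)| ≤
        bernsteinRadius (n * (P.real W * β.real B)) (vcComplexity d n δ) := by
  have hH' : MeasurableClass H ((P.prod β).map fun u => u.1.1) := by
    have hlaw : (P.prod β).map (fun u => u.1.1) = P.map Prod.fst := by
      rw [← Function.comp_def Prod.fst Prod.fst, ← Measure.map_map measurable_fst measurable_fst,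
        Measure.map_fst_prod, measure_univ, one_smul]
    rwa [hlaw]
  have hdev := holdsUpTo_card_deviation_le_bernsteinRadius (n := n)
    (p := fun c (u : DataPoint X × Bool) => p c u.1 ∧ u.2 ∈ B) (W := W ×ˢ B)
    (fun c => (hp c).prod B.measurableSet) (hW.prod B.measurableSet)
    (fun c => Set.prod_mono_left (hpW c)) hd hd1 (by fun_prop) hH' hn hδ0 hδ1
  simp_rw [← measureReal_prod_prod]
  exact hdev

lemma holdsUpTo_isRepresentative (hβ : β.real {true} = α) (hd : vcDim H ≤ d) (hd1 : 1 ≤ d)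
    (hH : MeasurableClass H (P.map Prod.fst)) (hn : 1 ≤ n) (hδ0 : 0 < δ) (hδ1 : δ ≤ 1) :
    HoldsUpTo (Measure.pi fun _ : Fin n => P.prod β) (3 / 4 * δ) fun z => ∀ h ∈ H,
      IsRepresentative P α (vcComplexity d n δ) (fun i => (z i).1) (fun i => (z i).2) h := by
  have hmarked := holdsUpTo_marked_card_deviation (P := P) (β := β) (n := n)
    (p := fun _ _ => True) {true} (fun _ => .univ) .univ (fun _ => le_rfl) hd hd1 hH hn hδ0 hδ1
  have herrors := holdsUpTo_marked_card_deviation (P := P) (β := β) (n := n)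
    (p := fun c v => c ≠ v.2.2) Finset.univ (fun _ => by measurability) .univ
    (fun _ => Set.subset_univ _) hd hd1 hH hn hδ0 hδ1
  have hcount := fun a => holdsUpTo_marked_card_deviation (P := P) (β := β) (n := n)
    (p := fun _ v => v.2.1 = a) {false} (fun _ => measurableSet_group a) (measurableSet_group a)
    (fun _ => le_rfl) hd hd1 hH hn hδ0 hδ1
  have hpositives := fun a => holdsUpTo_marked_card_deviation (P := P) (β := β) (n := n)
    (p := fun c v => c = 1 ∧ v.2.1 = a) {false}
    (fun c => (MeasurableSet.const _).inter (measurableSet_group a)) (measurableSet_group a)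
    (fun _ _ hv => hv.2) hd hd1 hH hn hδ0 hδ1
  simp only [Finset.coe_singleton, Finset.mem_singleton, hβ, real_singleton_false hβ,
    Finset.coe_univ, Finset.mem_univ, and_true, true_and, and_assoc, probReal_univ, mul_one,
    one_mul, Set.ofPred_true, ← groupProb_mul_positiveRate] at hmarked herrors hcount hpositives
  refine le_trans ((((((hmarked.and herrors).and (hcount 0)).and (hcount 1)).and
    (hpositives 0)).and (hpositives 1)).mono ?_) (by linarith)
  rintro z ⟨⟨⟨⟨⟨h1, h2⟩, h3⟩, h4⟩, h5⟩, h6⟩ h hh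
  exact ⟨h1 h hh, h2 h hh, Fin.forall_fin_two.2 ⟨h3 h hh, h4 h hh⟩,
    Fin.forall_fin_two.2 ⟨h5 h hh, h6 h hh⟩⟩

lemma ext_of_real_singleton_true {β β' : Measure Bool} [IsProbabilityMeasure β]
    [IsProbabilityMeasure β'] (h : β.real {true} = β'.real {true}) : β = β' := by
  refine Measure.ext_of_singleton fun b => ?_
  rw [← measureReal_eq_measureReal_iff]
  cases b
  · rw [real_singleton_false h, real_singleton_false rfl]
  · exact h

end Sampling

namespace MaliciousSampling

variable {X Ω : Type*} [MeasurableSpace X] [MeasurableSpace Ω] {n : ℕ}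
  {P : Measure (DataPoint X)} {α : ℝ} {μ : Measure Ω} {clean : Ω → Dataset X n}
  {marked : Ω → Fin n → Bool} {corrupted : Ω → Dataset X n}

lemma map_clean_eq_pi [IsProbabilityMeasure μ]
    (hS : MaliciousSampling P α μ clean marked corrupted) :
    μ.map clean = Measure.pi fun _ => P := by
  have hmeas (i) : AEMeasurable (fun ω => clean ω i) μ :=
    (measurable_pi_iff.1 hS.measurable_clean i).aemeasurable
  simpa only [hS.clean_law] using (iIndepFun_iff_map_fun_eq_pi_map hmeas).1 hS.clean_indep

lemma exists_map_marked_eq_pi [IsProbabilityMeasure μ]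
    (hS : MaliciousSampling P α μ clean marked corrupted) (hn : 1 ≤ n) :
    ∃ β : Measure Bool, IsProbabilityMeasure β ∧ β.real {true} = α ∧
      μ.map marked = Measure.pi fun _ => β := by
  have hmeas := measurable_pi_iff.1 hS.measurable_marked
  have hprob (i) : IsProbabilityMeasure (μ.map fun ω => marked ω i) :=
    Measure.isProbabilityMeasure_map (hmeas i).aemeasurable
  have htrue (i) : (μ.map fun ω => marked ω i).real {true} = α := by
    rw [map_measureReal_apply (hmeas i) (measurableSet_singleton true)]
    exact hS.marked_prob i
  let i₀ : Fin n := ⟨0, hn⟩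
  have hident (i) : μ.map (fun ω => marked ω i) = μ.map fun ω => marked ω i₀ :=
    ext_of_real_singleton_true (by rw [htrue, htrue])
  refine ⟨μ.map fun ω => marked ω i₀, hprob i₀, htrue i₀, ?_⟩
  simpa only [hident] using
    (iIndepFun_iff_map_fun_eq_pi_map fun i => (hmeas i).aemeasurable).1 hS.marked_indep

lemma exists_map_prodMk_eq_pi [IsProbabilityMeasure P] [IsProbabilityMeasure μ]
    (hS : MaliciousSampling P α μ clean marked corrupted) (hn : 1 ≤ n) :
    ∃ β : Measure Bool, IsProbabilityMeasure β ∧ β.real {true} = α ∧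
      μ.map (fun ω i => (clean ω i, marked ω i)) = Measure.pi fun _ => P.prod β := by
  obtain ⟨β, hβ, hβtrue, hmarked⟩ := hS.exists_map_marked_eq_pi hn
  have hpair : μ.map (fun ω => (clean ω, marked ω)) =
      (Measure.pi fun _ => P).prod (Measure.pi fun _ => β) := by
    rw [(indepFun_iff_map_prod_eq_prod_map_map hS.measurable_clean.aemeasurable
      hS.measurable_marked.aemeasurable).1 hS.clean_marked_indep, hS.map_clean_eq_pi, hmarked]
  have hzip := (measurePreserving_arrowProdEquivProdArrow (DataPoint X) Bool (Fin n) (fun _ => P)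
    fun _ => β).symm
  refine ⟨β, hβ, hβtrue, ?_⟩
  rw [← hzip.map_eq, ← hpair,
    Measure.map_map hzip.measurable (hS.measurable_clean.prodMk hS.measurable_marked)]
  rfl

lemma holdsUpTo_isRepresentative [IsProbabilityMeasure P] [IsProbabilityMeasure μ]
    (hS : MaliciousSampling P α μ clean marked corrupted) {H : Set (X → Fin 2)} {d : ℕ}
    (hd : vcDim H ≤ d) (hd1 : 1 ≤ d) (hH : MeasurableClass H (P.map Prod.fst)) (hn : 1 ≤ n) {δ : ℝ}
    (hδ0 : 0 < δ) (hδ1 : δ ≤ 1) :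
    HoldsUpTo μ (3 / 4 * δ) fun ω => ∀ h ∈ H,
      IsRepresentative P α (vcComplexity d n δ) (clean ω) (marked ω) h := by
  obtain ⟨β, hβ, hβtrue, hlaw⟩ := hS.exists_map_prodMk_eq_pi hn
  have hmeas : Measurable fun ω i => (clean ω i, marked ω i) := measurable_pi_lambda _ fun i =>
    (measurable_pi_iff.1 hS.measurable_clean i).prodMk (measurable_pi_iff.1 hS.measurable_marked i)
  have hprod :=
    FairLearning.holdsUpTo_isRepresentative (n := n) (P := P) hβtrue hd hd1 hH hn hδ0 hδ1
  rw [← hlaw] at hprod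
  exact HoldsUpTo.of_map hmeas.aemeasurable hprod

lemma power_mem_Icc [IsProbabilityMeasure μ] (hS : MaliciousSampling P α μ clean marked corrupted)
    (hn : 1 ≤ n) : α ∈ Set.Icc (0 : ℝ) 1 := by
  rw [← hS.marked_prob ⟨0, hn⟩]
  exact ⟨measureReal_nonneg, measureReal_le_one⟩

end MaliciousSampling

section Corruption

variable {X : Type*} {n : ℕ} {S S' : Dataset X n} {m : Fin n → Bool}

/-- The number of marked points of group `a`. -/
def markedCount (S : Dataset X n) (m : Fin n → Bool) (a : Fin 2) : ℕ :=
  (Finset.univ.filter fun i => (S i).2.1 = a ∧ m i = true).card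

lemma card_filter_unmarked_add_marked (p : Fin n → Prop) [DecidablePred p] (m : Fin n → Bool) :
    (Finset.univ.filter fun i => p i ∧ m i = false).card +
      (Finset.univ.filter fun i => p i ∧ m i = true).card = (Finset.univ.filter p).card := by
  rw [← Finset.card_filter_add_card_filter_not (s := Finset.univ.filter p) fun i => m i = false]
  simp only [Finset.filter_filter, Bool.not_eq_false]

lemma markedCount_zero_add_one (S : Dataset X n) (m : Fin n → Bool) :
    markedCount S m 0 + markedCount S m 1 = (Finset.univ.filter fun i => m i = true).card := by
  have hne : ∀ a : Fin 2, ¬ a = 0 ↔ a = 1 := by decide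
  rw [← Finset.card_filter_add_card_filter_not (s := Finset.univ.filter fun i => m i = true)
    fun i => (S i).2.1 = 0]
  simp only [markedCount, Finset.filter_filter, hne, and_comm]

lemma abs_empRisk_sub_empRisk_le (hSS' : ∀ i, m i = false → S' i = S i) (h : X → Fin 2) :
    |empRisk S' h - empRisk S h| ≤ ((Finset.univ.filter fun i => m i = true).card : ℝ) / n := by
  have hle : ∀ {T T' : Dataset X n}, (∀ i, m i = false → T' i = T i) →
      ((Finset.univ.filter fun i => h (T' i).1 ≠ (T' i).2.2).card : ℝ) ≤
        (Finset.univ.filter fun i => h (T i).1 ≠ (T i).2.2).card +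
          (Finset.univ.filter fun i => m i = true).card := by
    intro T T' hT
    refine mod_cast (Finset.card_le_card fun i hi => ?_).trans (Finset.card_union_le _ _)
    simp only [Finset.mem_union, Finset.mem_filter, Finset.mem_univ, true_and] at hi ⊢
    cases hm : m i
    · exact Or.inl (hT i hm ▸ hi)
    · exact Or.inr rfl
  have hupper := hle hSS'
  have hlower := hle fun i hi => (hSS' i hi).symm
  unfold empRisk
  rw [← sub_div, abs_div, Nat.abs_cast]
  gcongr
  exact abs_sub_le_iff.2 ⟨by linarith, by linarith⟩

lemma abs_add_div_add_sub_div_le {k j c e : ℝ} (hk0 : 0 ≤ k) (hkc : k ≤ c) (hj0 : 0 ≤ j)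
    (hje : j ≤ e) (hc : 0 < c) : |(k + j) / (c + e) - k / c| ≤ e / (c + e) := by
  have he : 0 ≤ e := hj0.trans hje
  have hr0 : 0 ≤ k / c := by positivity
  have hr1 : k / c ≤ 1 := (div_le_one hc).2 hkc
  have hdiff : (k + j) / (c + e) - k / c = (j - k / c * e) / (c + e) := by field_simp; ring
  rw [hdiff, abs_div, abs_of_pos (by positivity : 0 < c + e)]
  gcongr
  exact abs_le.2 ⟨by nlinarith, by nlinarith⟩

lemma abs_empPositiveRate_sub_le (hSS' : ∀ i, m i = false → S' i = S i) (h : X → Fin 2) (a : Fin 2)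
    (hc : 0 < unmarkedCount S m a) :
    |empPositiveRate S' h a - (unmarkedPositives S m h a : ℝ) / unmarkedCount S m a| ≤
      (markedCount S' m a : ℝ) / (unmarkedCount S m a + markedCount S' m a) := by
  have hcount : unmarkedCount S m a = unmarkedCount S' m a := by
    unfold unmarkedCount
    congr 1
    grind
  have hpositives : unmarkedPositives S m h a = unmarkedPositives S' m h a := by
    unfold unmarkedPositives
    congr 1
    grind
  rw [hcount] at hc ⊢
  rw [hpositives, empPositiveRate, ← card_filter_unmarked_add_marked _ m,
    ← card_filter_unmarked_add_marked (fun i => (S' i).2.1 = a) m]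
  simp only [and_assoc]
  push_cast
  refine abs_add_div_add_sub_div_le (by positivity) ?_ (by positivity) ?_ (mod_cast hc)
  · exact mod_cast Finset.card_le_card
      (Finset.monotone_filter_right _ fun _ _ hi => hi.2)
  · exact mod_cast Finset.card_le_card
      (Finset.monotone_filter_right _ fun _ _ hi => hi.2)

lemma div_add_div_le_deltaPar_add {c₀ c₁ m₀ m₁ α P₀ N E : ℝ} (hP₀ : 0 < P₀) (hN : 0 < N)
    (hα : 0 ≤ α) (hE : 0 ≤ E) (hm₀ : 0 ≤ m₀) (hm₁ : 0 ≤ m₁) (hc₀ : P₀ * N / 4 ≤ c₀)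
    (hc₁ : P₀ * N / 4 ≤ c₁) (hm : m₀ + m₁ ≤ 3 / 2 * α * N + E) :
    m₀ / (c₀ + m₀) + m₁ / (c₁ + m₁) ≤ deltaPar α P₀ + 4 * E / (P₀ * N) := by
  set c := P₀ * N / 4 with hc
  have hc0 : 0 < c := by positivity
  calc m₀ / (c₀ + m₀) + m₁ / (c₁ + m₁) ≤ m₀ / (c + m₀) + m₁ / (c + m₁) := by gcongr
    _ ≤ 2 * (m₀ + m₁) / (2 * c + (m₀ + m₁)) := by
        rw [div_add_div _ _ (by positivity) (by positivity),
          div_le_div_iff₀ (by positivity) (by positivity)]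
        nlinarith [mul_nonneg hc0.le (sq_nonneg (m₀ - m₁)), mul_nonneg hm₀ hm₁]
    _ ≤ 2 * (3 / 2 * α * N + E) / (2 * c + (3 / 2 * α * N + E)) := by
        rw [div_le_div_iff₀ (by positivity) (by positivity)]
        nlinarith
    _ = 2 * (3 / 2 * α * N) / (2 * c + (3 / 2 * α * N + E)) +
          2 * E / (2 * c + (3 / 2 * α * N + E)) := by ring
    _ ≤ 2 * (3 / 2 * α * N) / (2 * c + 3 / 2 * α * N) + 2 * E / (2 * c) := by
        gcongr
        · linarith
        · nlinarith [mul_nonneg hα hN.le]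
    _ = deltaPar α P₀ + 4 * E / (P₀ * N) := by
        rw [deltaPar, hc]
        field_simp
        ring

end Corruption

section Estimation

lemma bernsteinRadius_le_half_add {N D : ℝ} (hN : 0 ≤ N) (hD : 0 ≤ D) :
    bernsteinRadius N D ≤ N / 2 + 40 * D := by
  have hroot : √(N * D) ≤ N / 16 + 4 * D :=
    Real.sqrt_le_iff.2 ⟨by positivity, by nlinarith [sq_nonneg (N / 16 - 4 * D)]⟩
  unfold bernsteinRadius
  linarith

lemma bernsteinRadius_eq_mul {N : ℝ} (hN : 0 < N) {D : ℝ} (hD : 0 ≤ D) :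
    bernsteinRadius N D = 8 * (√(D / N) + √(D / N) ^ 2) * N := by
  have hroot : √(N * D) = N * √(D / N) := by
    rw [show N * D = N ^ 2 * (D / N) by field_simp, Real.sqrt_mul (by positivity),
      Real.sqrt_sq hN.le]
  rw [bernsteinRadius, hroot, Real.sq_sqrt (by positivity)]
  field_simp

lemma half_le_and_abs_div_sub_le {k c N p r : ℝ} (hN : 0 < N) (hp : p ∈ Set.Icc (0 : ℝ) 1)
    (hr : r ≤ 1 / 2) (hk : |k - N * p| ≤ r * N) (hc : |c - N| ≤ r * N) :
    N / 2 ≤ c ∧ |k / c - p| ≤ 4 * r := by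
  have hr0 : 0 ≤ r := nonneg_of_mul_nonneg_left ((abs_nonneg _).trans hc) hN
  have hcN : N / 2 ≤ c := by nlinarith [(abs_le.1 hc).1]
  have hc0 : 0 < c := by linarith
  refine ⟨hcN, ?_⟩
  rw [div_sub' hc0.ne', abs_div, abs_of_pos hc0, div_le_iff₀ hc0]
  calc |k - c * p| = |(k - N * p) - p * (c - N)| := by ring_nf
    _ ≤ |k - N * p| + |p * (c - N)| := abs_sub _ _
    _ ≤ r * N + 1 * (r * N) := by
        rw [abs_mul, abs_of_nonneg hp.1]
        gcongr
        exact hp.2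
    _ ≤ 4 * r * c := by nlinarith

variable {X : Type*} {n : ℕ} {S S' : Dataset X n} {m : Fin n → Bool}

lemma empRisk_mem_Icc (S : Dataset X n) (h : X → Fin 2) : empRisk S h ∈ Set.Icc (0 : ℝ) 1 := by
  unfold empRisk
  refine ⟨by positivity, div_le_one_of_le₀ ?_ (by positivity)⟩
  exact mod_cast (Finset.card_le_univ _).trans_eq (Fintype.card_fin n)

lemma empParityDeviation_mem_Icc (S : Dataset X n) (h : X → Fin 2) :
    empParityDeviation S h ∈ Set.Icc (0 : ℝ) 1 := by
  have hrate (a : Fin 2) : empPositiveRate S h a ∈ Set.Icc (0 : ℝ) 1 := by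
    refine ⟨by unfold empPositiveRate; positivity, div_le_one_of_le₀ ?_ (by positivity)⟩
    exact mod_cast Finset.card_le_card (Finset.monotone_filter_right _ fun _ _ hi => hi.2)
  exact ⟨abs_nonneg _, abs_sub_le_of_nonneg_of_le (hrate 0).1 (hrate 0).2 (hrate 1).1 (hrate 1).2⟩

variable [MeasurableSpace X]

lemma groupProb_zero_add_one (P : Measure (DataPoint X)) [IsProbabilityMeasure P] :
    groupProb P 0 + groupProb P 1 = 1 := by
  have hcompl : {z : DataPoint X | z.2.1 = 1} = {z | z.2.1 = 0}ᶜ := by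
    ext z
    simp only [Set.mem_ofPred_eq, Set.mem_compl_iff]
    omega
  rw [groupProb, groupProb, hcompl, probReal_add_probReal_compl (measurableSet_group 0)]

variable {P : Measure (DataPoint X)} {h : X → Fin 2} {α D P₀ : ℝ}

lemma positiveRate_mem_Icc (P : Measure (DataPoint X)) (h : X → Fin 2) (a : Fin 2) :
    positiveRate P h a ∈ Set.Icc (0 : ℝ) 1 := by
  unfold positiveRate
  exact ⟨measureReal_nonneg, measureReal_le_one⟩

lemma parityDeviation_mem_Icc (P : Measure (DataPoint X)) (h : X → Fin 2) :
    parityDeviation P h ∈ Set.Icc (0 : ℝ) 1 := by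
  have hrate := positiveRate_mem_Icc P h
  exact ⟨abs_nonneg _, abs_sub_le_of_nonneg_of_le (hrate 0).1 (hrate 0).2 (hrate 1).1 (hrate 1).2⟩

lemma IsRepresentative.card_marked_le (hrep : IsRepresentative P α D S m h) (hα : 0 ≤ α)
    (hD : 0 ≤ D) :
    ((Finset.univ.filter fun i => m i = true).card : ℝ) ≤ 3 / 2 * α * n + 40 * D := by
  have hmean : 0 ≤ n * α := by positivity
  linarith [(abs_le.1 hrep.marked).2, bernsteinRadius_le_half_add hmean hD]

lemma IsRepresentative.abs_empRisk_sub_risk_le [IsProbabilityMeasure P]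
    (hrep : IsRepresentative P α D S m h) (hSS' : ∀ i, m i = false → S' i = S i) (hα : 0 ≤ α)
    (hD : 0 ≤ D) (hn : 1 ≤ n) :
    |empRisk S' h - risk P h| ≤ 3 / 2 * α + 56 * √(D / n) := by
  have hn0 : (0 : ℝ) < n := mod_cast hn
  set ρ := √(D / n) with hρ
  have hρ0 : 0 ≤ ρ := Real.sqrt_nonneg _
  rcases le_or_gt 1 ρ with hρ1 | hρ1
  · obtain ⟨h0, h1⟩ := empRisk_mem_Icc S' h
    have hle : |empRisk S' h - risk P h| ≤ 1 :=
      abs_sub_le_of_nonneg_of_le h0 h1 measureReal_nonneg measureReal_le_one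
    linarith
  have hDρ : D = ρ ^ 2 * n := by rw [hρ, Real.sq_sqrt (by positivity)]; field_simp
  have hclean : |empRisk S h - risk P h| ≤ 8 * (ρ + ρ ^ 2) := by
    rw [empRisk, div_sub' hn0.ne', abs_div, abs_of_pos hn0, div_le_iff₀ hn0,
      ← bernsteinRadius_eq_mul hn0 hD]
    exact hrep.errors
  have hmarks : ((Finset.univ.filter fun i => m i = true).card : ℝ) / n ≤
      3 / 2 * α + 40 * ρ ^ 2 := by
    rw [div_le_iff₀ hn0]
    linarith [hrep.card_marked_le hα hD]
  calc |empRisk S' h - risk P h| ≤ |empRisk S' h - empRisk S h| + |empRisk S h - risk P h| :=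
        abs_sub_le _ _ _
    _ ≤ (3 / 2 * α + 40 * ρ ^ 2) + 8 * (ρ + ρ ^ 2) :=
        add_le_add ((abs_empRisk_sub_empRisk_le hSS' h).trans hmarks) hclean
    _ ≤ _ := by nlinarith

lemma IsRepresentative.abs_unmarkedRate_sub_positiveRate_le (hrep : IsRepresentative P α D S m h)
    (hα : α ≤ 1 / 2) (hP₀ : 0 < P₀) {a : Fin 2} (ha : P₀ ≤ groupProb P a) (hD : 0 ≤ D)
    (hn : 1 ≤ n) (hτ : √(D / (P₀ * n)) ≤ 1 / 46) :
    P₀ * n / 4 ≤ unmarkedCount S m a ∧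
      |(unmarkedPositives S m h a : ℝ) / unmarkedCount S m a - positiveRate P h a| ≤
        52 * √(D / (P₀ * n)) := by
  have hn0 : (0 : ℝ) < n := mod_cast hn
  set N := n * (groupProb P a * (1 - α)) with hN
  set ρ := √(D / N) with hρ
  have hNle : P₀ * n / 2 ≤ N := by
    calc P₀ * n / 2 = n * (P₀ * (1 / 2)) := by ring
      _ ≤ N := by
        rw [hN]
        have hα' : 1 / 2 ≤ 1 - α := by linarith
        gcongr
        exact hP₀.le.trans ha
  have hN0 : 0 < N := lt_of_lt_of_le (by positivity) hNle
  -- `13 / 9` is an upper approximation of `√2`.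
  have hρτ : ρ ≤ 13 / 9 * √(D / (P₀ * n)) := by
    calc ρ ≤ √((13 / 9) ^ 2 * (D / (P₀ * n))) := Real.sqrt_le_sqrt (by
          rw [← mul_div_assoc, div_le_div_iff₀ hN0 (by positivity)]; nlinarith)
      _ = _ := by rw [Real.sqrt_mul (by positivity), Real.sqrt_sq (by positivity)]
  have hρ0 : 0 ≤ ρ := Real.sqrt_nonneg _
  have hρ1 : ρ ≤ 1 / 31 := by linarith
  have hradius : bernsteinRadius N D ≤ 9 * ρ * N := by
    rw [bernsteinRadius_eq_mul hN0 hD, ← hρ]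
    have : 8 * (ρ + ρ ^ 2) ≤ 9 * ρ := by nlinarith
    gcongr
  have hpos := hrep.positives a
  rw [show n * (groupProb P a * positiveRate P h a * (1 - α)) = N * positiveRate P h a by ring]
    at hpos
  obtain ⟨hcount, hrate⟩ := half_le_and_abs_div_sub_le hN0 (positiveRate_mem_Icc P h a)
    (by linarith) (hpos.trans hradius) ((hrep.count a).trans hradius)
  exact ⟨by linarith, by linarith⟩

lemma deltaPar_nonneg {α P₀ : ℝ} (hα : 0 ≤ α) (hP₀ : 0 ≤ P₀) : 0 ≤ deltaPar α P₀ := by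
  unfold deltaPar
  positivity

lemma one_le_deltaPar {α P₀ : ℝ} (hP₀ : 0 < P₀) (hα : P₀ / 3 ≤ α) : 1 ≤ deltaPar α P₀ := by
  rw [deltaPar, one_le_div (by linarith)]
  linarith

lemma IsRepresentative.abs_empParityDeviation_sub_le_add (hrep : IsRepresentative P α D S m h)
    (hSS' : ∀ i, m i = false → S' i = S i) (hα0 : 0 ≤ α) (hα : α ≤ 1 / 2) (hP₀ : 0 < P₀)
    (hP : ∀ a, P₀ ≤ groupProb P a) (hD : 0 ≤ D) (hn : 1 ≤ n) (hτ : √(D / (P₀ * n)) ≤ 1 / 46) :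
    |empParityDeviation S' h - parityDeviation P h| ≤
      deltaPar α P₀ + 160 * √(D / (P₀ * n)) ^ 2 + 104 * √(D / (P₀ * n)) := by
  have hn0 : (0 : ℝ) < n := mod_cast hn
  have hclean := fun a => hrep.abs_unmarkedRate_sub_positiveRate_le hα hP₀ (hP a) hD hn hτ
  have hgroup (a : Fin 2) : |empPositiveRate S' h a - positiveRate P h a| ≤
      (markedCount S' m a : ℝ) / (unmarkedCount S m a + markedCount S' m a) +
        52 * √(D / (P₀ * n)) := by
    have hpos : (0 : ℝ) < unmarkedCount S m a := lt_of_lt_of_le (by positivity) (hclean a).1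
    exact (abs_sub_le _ _ _).trans
      (add_le_add (abs_empPositiveRate_sub_le hSS' h a (mod_cast hpos)) (hclean a).2)
  have hmarks : (markedCount S' m 0 : ℝ) + markedCount S' m 1 ≤ 3 / 2 * α * n + 40 * D := by
    exact_mod_cast markedCount_zero_add_one S' m ▸ hrep.card_marked_le hα0 hD
  have hcorrupt := div_add_div_le_deltaPar_add hP₀ hn0 hα0 (by positivity : 0 ≤ 40 * D)
    (Nat.cast_nonneg _) (Nat.cast_nonneg _) (hclean 0).1 (hclean 1).1 hmarks
  have hsq : 4 * (40 * D) / (P₀ * n) = 160 * √(D / (P₀ * n)) ^ 2 := by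
    rw [Real.sq_sqrt (by positivity)]
    ring
  calc |empParityDeviation S' h - parityDeviation P h|
      ≤ |(empPositiveRate S' h 0 - empPositiveRate S' h 1) -
          (positiveRate P h 0 - positiveRate P h 1)| := abs_abs_sub_abs_le_abs_sub _ _
    _ = |(empPositiveRate S' h 0 - positiveRate P h 0) -
          (empPositiveRate S' h 1 - positiveRate P h 1)| := by ring_nf
    _ ≤ |empPositiveRate S' h 0 - positiveRate P h 0| +
          |empPositiveRate S' h 1 - positiveRate P h 1| := abs_sub _ _
    _ ≤ _ := by linarith [hgroup 0, hgroup 1]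

lemma IsRepresentative.abs_empParityDeviation_sub_le [IsProbabilityMeasure P]
    (hrep : IsRepresentative P α D S m h) (hSS' : ∀ i, m i = false → S' i = S i) (hα : 0 ≤ α)
    (hP₀ : 0 < P₀) (hP : ∀ a, P₀ ≤ groupProb P a) (hD : 0 ≤ D) (hn : 1 ≤ n) :
    |empParityDeviation S' h - parityDeviation P h| ≤
      deltaPar α P₀ + 108 * √(D / (P₀ * n)) := by
  set τ := √(D / (P₀ * n))
  have hτ0 : 0 ≤ τ := Real.sqrt_nonneg _
  have htriv : |empParityDeviation S' h - parityDeviation P h| ≤ 1 := by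
    obtain ⟨h0, h1⟩ := empParityDeviation_mem_Icc S' h
    obtain ⟨h2, h3⟩ := parityDeviation_mem_Icc P h
    exact abs_sub_le_of_nonneg_of_le h0 h1 h2 h3
  rcases le_or_gt (P₀ / 3) α with hαP | hαP
  · linarith [one_le_deltaPar hP₀ hαP]
  rcases lt_or_ge (1 / 46) τ with hτ1 | hτ1
  · linarith [deltaPar_nonneg hα hP₀.le]
  have hP₀1 : P₀ ≤ 1 / 2 := by linarith [hP 0, hP 1, groupProb_zero_add_one P]
  have := hrep.abs_empParityDeviation_sub_le_add hSS' hα (by linarith) hP₀ hP hD hn hτ1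
  nlinarith

end Estimation

section Learning

variable {X Ω : Type*} [MeasurableSpace X] [MeasurableSpace Ω] {n : ℕ} {H : Set (X → Fin 2)}
  {P : Measure (DataPoint X)} {lam : ℝ}

lemma weightedObjective_le_iInf_add (hlam : 0 ≤ lam) {S : Dataset X n} {g : X → Fin 2}
    (hg : g ∈ H) (hmin : ∀ h ∈ H, empObjective S lam g ≤ empObjective S lam h) {ε η : ℝ}
    (hrisk : ∀ h ∈ H, |empRisk S h - risk P h| ≤ ε)
    (hpar : ∀ h ∈ H, |empParityDeviation S h - parityDeviation P h| ≤ η) :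
    weightedObjective P lam g ≤ (⨅ h : H, weightedObjective P lam h) + 2 * (ε + lam * η) := by
  have : Nonempty H := ⟨⟨g, hg⟩⟩
  have hobj (h : X → Fin 2) (hh : h ∈ H) :
      |empObjective S lam h - weightedObjective P lam h| ≤ ε + lam * η := by
    calc |empObjective S lam h - weightedObjective P lam h|
        = |(empRisk S h - risk P h) +
            lam * (empParityDeviation S h - parityDeviation P h)| := by
          unfold empObjective weightedObjective
          ring_nf
      _ ≤ |empRisk S h - risk P h| + |lam * (empParityDeviation S h - parityDeviation P h)| :=
          abs_add_le _ _
      _ ≤ ε + lam * η := by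
          rw [abs_mul, abs_of_nonneg hlam]
          gcongr
          exacts [hrisk h hh, hpar h hh]
  rw [← sub_le_iff_le_add]
  refine le_ciInf fun ⟨h, hh⟩ => ?_
  linarith [(abs_le.1 (hobj g hg)).1, (abs_le.1 (hobj h hh)).2, hmin h hh]

lemma weightedObjective_le_iInf_of_vcDim_eq_zero (hH : vcDim H = 0) {g : X → Fin 2} (hg : g ∈ H) :
    weightedObjective P lam g ≤ ⨅ h : H, weightedObjective P lam h :=
  have : Nonempty H := ⟨⟨g, hg⟩⟩
  le_ciInf fun h => by rw [eq_of_vcDim_eq_zero hH h.2 hg]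

lemma sqrt_vcComplexity_div (d n : ℕ) (δ : ℝ) {N : ℝ} (hN : 0 ≤ N) :
    √(vcComplexity d n δ / N) = √(Real.log (2 * n / δ)) * √(d / N) := by
  rw [vcComplexity, mul_comm, mul_div_assoc, Real.sqrt_mul' _ (by positivity)]

lemma deltaPar_le {α P₀ : ℝ} (hα : 0 ≤ α) (hP₀ : 0 < P₀) : deltaPar α P₀ ≤ 6 * (α / P₀) := by
  rw [deltaPar, mul_div_assoc', div_le_div_iff₀ (by positivity) hP₀]
  nlinarith

lemma le_groupProb [IsProbabilityMeasure P] (hP : groupProb P 0 ≤ 1 / 2) (a : Fin 2) :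
    groupProb P 0 ≤ groupProb P a := by
  have hadd := groupProb_zero_add_one P
  fin_cases a
  · exact le_rfl
  · exact (by linarith : groupProb P 0 ≤ groupProb P 1)

lemma one_le_of_log_div_le {α P₀ δ : ℝ} (hα : α < 1) (hP₀ : 0 < P₀) (hδ0 : 0 < δ) (hδ1 : δ < 16)
    (hn : 8 * Real.log (16 / δ) / ((1 - α) * P₀) ≤ n) : 1 ≤ n := by
  have hlog : 0 < Real.log (16 / δ) := Real.log_pos ((one_lt_div hδ0).2 hδ1)
  have hden : 0 < (1 - α) * P₀ := mul_pos (by linarith) hP₀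
  exact_mod_cast (div_pos (mul_pos (by norm_num) hlog) hden).trans_le hn

end Learning

end FairLearning

open FairLearning in
theorem theorem5_general {X Ω : Type*} [MeasurableSpace X] [MeasurableSpace Ω]
    {H : Set (X → Fin 2)} {d : ℕ} (hd : vcDim H ≤ d) {lam : ℝ} (hlam : 0 ≤ lam)
    {P : Measure (DataPoint X)} [IsProbabilityMeasure P] (hH : MeasurableClass H (P.map Prod.fst))
    {P₀ : ℝ} (hP₀ : 0 < P₀) (hP : ∀ a, P₀ ≤ groupProb P a) {δ : ℝ} (hδ0 : 0 < δ) (hδ1 : δ ≤ 1)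
    {n : ℕ} (hn : 1 ≤ n) {μ : Measure Ω} [IsProbabilityMeasure μ] {α : ℝ}
    {clean : Ω → Dataset X n} {marked : Ω → Fin n → Bool} {corrupted : Ω → Dataset X n}
    (hS : MaliciousSampling P α μ clean marked corrupted) {g : Ω → X → Fin 2}
    (hg : ∀ ω, g ω ∈ H)
    (hmin : ∀ ω, ∀ h ∈ H, empObjective (corrupted ω) lam (g ω) ≤
      empObjective (corrupted ω) lam h) :
    ∃ E : Set Ω, MeasurableSet E ∧ 1 - δ < μ.real E ∧
      ∀ ω ∈ E, weightedObjective P lam (g ω) ≤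
        (⨅ h : H, weightedObjective P lam h) +
          (3 * α + lam * (2 * deltaPar α P₀) +
            216 * √(Real.log (2 * n / δ)) * (√((d : ℝ) / n) + lam * √((d : ℝ) / (P₀ * n)))) := by
  have hα : 0 ≤ α := (hS.power_mem_Icc hn).1
  rcases Nat.eq_zero_or_pos d with rfl | hd1
  · refine ⟨Set.univ, .univ, by simpa using hδ0, fun ω _ => ?_⟩
    have hΔ := deltaPar_nonneg hα hP₀.le
    exact (weightedObjective_le_iInf_of_vcDim_eq_zero (nonpos_iff_eq_zero.1 hd) (hg ω)).trans
      (le_add_of_nonneg_right (by positivity))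
  have hD := (vcComplexity_pos hd1 hn hδ0 hδ1).le
  obtain ⟨E, hE, hμE, hgood⟩ := ((hS.holdsUpTo_isRepresentative hd hd1 hH hn hδ0 hδ1).and
    (.of_ae hS.unmarked_eq)).exists_measurableSet (by linarith : 3 / 4 * δ + 0 < δ)
  refine ⟨E, hE, hμE, fun ω hω => ?_⟩
  obtain ⟨hrep, hcorrupted⟩ := hgood ω hω
  refine (weightedObjective_le_iInf_add hlam (hg ω) (hmin ω)
    (fun h hh => (hrep h hh).abs_empRisk_sub_risk_le hcorrupted hα hD hn)
    (fun h hh => (hrep h hh).abs_empParityDeviation_sub_le hcorrupted hα hP₀ hP hD hn)).trans ?_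
  rw [sqrt_vcComplexity_div _ _ _ n.cast_nonneg, sqrt_vcComplexity_div _ _ _ (by positivity)]
  have : 0 ≤ √(Real.log (2 * n / δ)) * √((d : ℝ) / n) := by positivity
  linarith

theorem theorem5 :
    ∃ C K : ℝ, 0 < C ∧ 0 < K ∧
      ∀ (X : Type*) [MeasurableSpace X]
        (H : Set (X → Fin 2)) (d : ℕ) (_ : FairLearning.vcDim H = (d : ℕ∞))
        (lam : ℝ) (_ : 0 ≤ lam)
        (learner : (n : ℕ) → FairLearning.Dataset X n → (X → Fin 2))
        (_ : FairLearning.MinimizesEmpObjective H lam learner)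
        (P : Measure (FairLearning.DataPoint X)) [IsProbabilityMeasure P]
        (_ : FairLearning.MeasurableClass H (P.map Prod.fst))
        (P₀ : ℝ) (_ : P₀ = FairLearning.groupProb P 0) (_ : 0 < P₀) (_ : P₀ ≤ 1 / 2)
        (α : ℝ) (_ : 0 ≤ α) (_ : α < 1 / 2),
        FairLearning.deltaPar α P₀ ≤ K * (α / P₀) ∧
        ∀ (δ : ℝ) (_ : 0 < δ) (_ : δ < 1) (n : ℕ)
          (_ : 8 * Real.log (16 / δ) / ((1 - α) * P₀) ≤ n)
          (_ : 12 * Real.log (12 / δ) / α ≤ n)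
          (_ : (d : ℝ) / 2 ≤ n)
          (Ω : Type*) [MeasurableSpace Ω] (μ : Measure Ω) [IsProbabilityMeasure μ]
          (clean : Ω → FairLearning.Dataset X n) (marked : Ω → Fin n → Bool)
          (corrupted : Ω → FairLearning.Dataset X n)
          (_ : FairLearning.MaliciousSampling P α μ clean marked corrupted),
          ∃ E : Set Ω, MeasurableSet E ∧ 1 - δ < μ.real E ∧
            ∀ ω ∈ E,
              FairLearning.weightedObjective P lam (learner n (corrupted ω)) ≤
                (⨅ h : H, FairLearning.weightedObjective P lam h) +
                  (3 * α + lam * (2 * FairLearning.deltaPar α P₀) +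
                    C * √(Real.log (2 * n / δ)) *
                      (√((d : ℝ) / n) + lam * √((d : ℝ) / (P₀ * n)))) := by
  refine ⟨216, 6, by norm_num, by norm_num, ?_⟩
  rintro X _ H d hd lam hlam learner hlearn P _ hH _ rfl hP₀ hP₀' α hα hα'
  refine ⟨FairLearning.deltaPar_le hα hP₀, fun δ hδ0 hδ1 n hsize _ _ Ω _ μ _ clean marked
    corrupted hS => ?_⟩
  have hn : 1 ≤ n := FairLearning.one_le_of_log_div_le (by linarith) hP₀ hδ0 (by linarith) hsize
  exact theorem5_general hd.le hlam hH hP₀ (FairLearning.le_groupProb hP₀') hδ0 hδ1.le hn hS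
    (fun ω => (hlearn n hn (corrupted ω)).1) fun ω => (hlearn n hn (corrupted ω)).2
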